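/- A planar polygonal band $M$ is a finite disjoint union of bounded open polygons in the plane; each edge carries either the Dirichlet condition $u=0$ or the Neumann condition $\partial u/\partial n=0$. Let $u:M\times[0,\infty)\to\mathbb{R}$ be the unique solution of $\Delta u=\partial u/\partial t$ for $t>0$ with these boundary conditions and with $\lim_{t\downarrow 0}u(\cdot\,;t)=1$ in $L^2(M)$ (that is, $u(\cdot\,;t)=e^{t\Delta_M}1$ for the self-adjoint Laplacian $\Delta_M$ on $L^2(M)$ with the mixed boundary conditions). The heat content of $M$ is $Q_M(t)=\int_M u(x;t)\,dx$. Two bands $M_1,M_2$ are isoheat if $Q_{M_1}(t)=Q_{M_2}(t)$ for all $t>0$. Let $A$ be the disjoint union of a square of area $1$, one of whose edges has Neumann boundary conditions, a right-angled isosceles triangle of area $2$, and a right-angled isosceles triangle of area $\frac12$, whose hypotenuse (of length $\sqrt2$) has Neumann boundary conditions. Let $B$ be the disjoint union of a right-angled isosceles triangle of area $1$, one of whose two legs (of length $\sqrt2$) has Neumann boundary conditions, a rectangle with edges of lengths $1$ and $2$, and a right-angled isosceles triangle of area $\frac12$, one of whose two legs (of length $1$) has Neumann boundary conditions. All other edges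 in both $A$ and $B$ have Dirichlet boundary conditions. Then the heat problem on each of $A$ and $B$ has exactly one solution, and $A$ and $B$ are not isoheat. In particular, as $t\to\infty$, $$Q_A(t)=\frac{1600}{9\pi^4}e^{-5\pi^2t/4}+O(e^{-2\pi^2t}),\qquad Q_B(t)=\frac{1664}{9\pi^4}e^{-5\pi^2t/4}+O(e^{-2\pi^2t}).$$ -/

import Mathlib

open MeasureTheory Filter Topology Asymptotics
open scoped ContDiff ENNReal

/-- A planar domain with mixed boundary conditions: a bounded open set `carrier` of the plane
(below always an open convex polygon), with a closed part `dirichlet` of its boundary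
(below always a union of closed edges) carrying the Dirichlet condition. The rest of the boundary
carries the Neumann condition. -/
structure MixedDomain where
  carrier : Set (ℝ × ℝ)
  dirichlet : Set (ℝ × ℝ)

namespace MixedDomain

/-- Lebesgue measure on the domain. -/
noncomputable abbrev measure (P : MixedDomain) : Measure (ℝ × ℝ) :=
  volume.restrict P.carrier

/-- The real Hilbert space `L²` of the domain. -/
abbrev L2 (P : MixedDomain) : Type := Lp ℝ 2 P.measure

/-- `w` lies in the Sobolev space of `H¹` functions vanishing on the Dirichlet part of the
boundary, and its gradient is `(gx, gy)`. This space is the `H¹`-closure of the functions that are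
smooth up to the boundary and vanish near the Dirichlet part; no condition is imposed
on the Neumann part. -/
def HasGrad (P : MixedDomain) (w gx gy : P.L2) : Prop :=
  ∃ φ : ℕ → ℝ × ℝ → ℝ,
    (∀ n, ContDiff ℝ ∞ (φ n) ∧ Disjoint (tsupport (φ n)) P.dirichlet) ∧
    Tendsto (fun n => eLpNorm (fun p => φ n p - w p) 2 P.measure) atTop (𝓝 0) ∧
    Tendsto (fun n => eLpNorm (fun p => fderiv ℝ (φ n) p (1, 0) - gx p) 2 P.measure)
      atTop (𝓝 0) ∧
    Tendsto (fun n => eLpNorm (fun p => fderiv ℝ (φ n) p (0, 1) - gy p) 2 P.measure)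
      atTop (𝓝 0)

/-- `w` lies in the domain of the (self-adjoint) Laplacian with the mixed boundary conditions and
`Δ w = f`: the Dirichlet condition is membership in the form domain, and the Neumann condition is
the natural one, encoded by Green's formula against all functions of the form domain. -/
def HasLaplacian (P : MixedDomain) (w f : P.L2) : Prop :=
  ∃ gx gy : P.L2, P.HasGrad w gx gy ∧
    ∀ v hx hy : P.L2, P.HasGrad v hx hy →
      ∫ p, (gx p * hx p + gy p * hy p) ∂P.measure = -∫ p, f p * v p ∂P.measure

/-- `u` solves the heat equation `Δ u = ∂u/∂t` for `t > 0` with the mixed boundary conditions and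
with initial datum the constant function `1`, attained in `L²` as `t ↓ 0`. -/
def IsHeatFlow (P : MixedDomain) (u : ℝ → P.L2) : Prop :=
  (∀ᵐ p ∂P.measure, u 0 p = 1) ∧
  Tendsto u (𝓝[>] 0) (𝓝 (u 0)) ∧
  ∀ t : ℝ, 0 < t → ∃ f : P.L2, HasDerivAt u f t ∧ P.HasLaplacian (u t) f

/-- The open rectangle `(0, a) × (0, b)`. -/
def rectangle (a b : ℝ) : Set (ℝ × ℝ) :=
  {p | 0 < p.1 ∧ p.1 < a ∧ 0 < p.2 ∧ p.2 < b}

/-- The open right isosceles triangle with vertices `(0, 0)`, `(c, 0)`, `(c, c)`: its legs have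
length `c` and its area is `c ^ 2 / 2`. -/
def triangle (c : ℝ) : Set (ℝ × ℝ) :=
  {p | 0 < p.2 ∧ p.2 < p.1 ∧ p.1 < c}

/-- The rectangle with Dirichlet conditions on all four edges. -/
def rectangleD (a b : ℝ) : MixedDomain where
  carrier := rectangle a b
  dirichlet := segment ℝ (0, 0) (a, 0) ∪ segment ℝ (0, b) (a, b) ∪
    segment ℝ (0, 0) (0, b) ∪ segment ℝ (a, 0) (a, b)

/-- The rectangle with the Neumann condition on the edge from `(a, 0)` to `(a, b)` and Dirichlet
conditions on the other three edges. -/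
def rectangleN (a b : ℝ) : MixedDomain where
  carrier := rectangle a b
  dirichlet := segment ℝ (0, 0) (a, 0) ∪ segment ℝ (0, b) (a, b) ∪ segment ℝ (0, 0) (0, b)

/-- The right isosceles triangle with Dirichlet conditions on all three edges. -/
def triangleD (c : ℝ) : MixedDomain where
  carrier := triangle c
  dirichlet := segment ℝ (0, 0) (c, 0) ∪ segment ℝ (c, 0) (c, c) ∪ segment ℝ (0, 0) (c, c)

/-- The right isosceles triangle with the Neumann condition on the hypotenuse and Dirichlet
conditions on both legs. -/
def triangleNHyp (c : ℝ) : MixedDomain where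
  carrier := triangle c
  dirichlet := segment ℝ (0, 0) (c, 0) ∪ segment ℝ (c, 0) (c, c)

/-- The right isosceles triangle with the Neumann condition on one leg and Dirichlet
conditions on the other leg and on the hypotenuse. -/
def triangleNLeg (c : ℝ) : MixedDomain where
  carrier := triangle c
  dirichlet := segment ℝ (0, 0) (c, 0) ∪ segment ℝ (0, 0) (c, c)

end MixedDomain

/-- A three-piece band: the (abstract) disjoint union of three planar domains with mixed boundary
conditions. -/
abbrev Band : Type := Fin 3 → MixedDomain

namespace Band

/-- A function on the disjoint union is a triple of functions on the pieces. It solves the heat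
problem with initial datum `1` exactly when each of its restrictions to the pieces does. -/
def IsHeatFlow (M : Band) (u : ∀ i, ℝ → (M i).L2) : Prop :=
  ∀ i, (M i).IsHeatFlow (u i)

/-- The heat problem on the band has exactly one solution (on the time interval `[0, ∞)`). -/
def WellPosed (M : Band) : Prop :=
  (∃ u, M.IsHeatFlow u) ∧
  ∀ u v, M.IsHeatFlow u → M.IsHeatFlow v → ∀ i, ∀ t : ℝ, 0 ≤ t → u i t = v i t

open Classical in
/-- The heat content at time `t ≥ 0`: the integral over the band of the solution of the
heat problem (with the value `0` if there were no solution). -/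
noncomputable def heatContent (M : Band) (t : ℝ) : ℝ :=
  if h : ∃ u, M.IsHeatFlow u then ∑ i, ∫ p, h.choose i t p ∂(M i).measure else 0

/-- Two bands are isoheat if they have the same heat content at all times `t > 0`. -/
def Isoheat (M N : Band) : Prop :=
  ∀ t : ℝ, 0 < t → M.heatContent t = N.heatContent t

end Band

/-- The unit square with one Neumann edge, the Dirichlet triangle of area `2`, and the triangle of
area `1 / 2` with Neumann hypotenuse. -/
noncomputable def bandA : Band :=
  ![MixedDomain.rectangleN 1 1, MixedDomain.triangleD 2, MixedDomain.triangleNHyp 1]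

/-- The triangle of area `1` with one Neumann leg (of length `√2`), the `2 × 1` Dirichlet rectangle,
and the triangle of area `1 / 2` with one Neumann leg (of length `1`). -/
noncomputable def bandB : Band :=
  ![MixedDomain.triangleNLeg √2, MixedDomain.rectangleD 2 1, MixedDomain.triangleNLeg 1]

/-! On every piece the mixed Laplacian is diagonalized by explicit sines. On a rectangle the modes
are products of one-dimensional sine waves. On a right isosceles triangle they are combinations of
products on the square that are antisymmetric (Dirichlet hypotenuse) or symmetric (Neumann
hypotenuse) under reflection in the diagonal; a Neumann leg replaces the integer frequencies by
half-integer ones. Expanding the datum 1 in the modes ψ with eigenvalues λ gives the heat content as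
the sum of exp(-λt) (∫ψ)² / ∫ψ².

Only four pieces have an eigenvalue below 2π², and each of these has exactly one, equal to 5π²/4.
The weights are 64/π⁴ and 1024/(9π⁴) in A, against 512/(9π⁴) and 128/π⁴ in B. The sums differ, so
the heat contents differ for large t.

Four points carry the rigour. The Laplacian is a closed, dissipative linear relation
(`isClosed_laplacianGraph`, `HasLaplacian.inner_nonpos`): dissipativity gives uniqueness by the
energy method, closedness lets the spectral series solve the equation (`exists_flow_of_orthogonal`).
A smooth function that merely vanishes on the Dirichlet edges lies in the form domain, although the
test functions must vanish near them (`hasGrad_of_contDiff`). Green's formula shows that the modes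
are eigenfunctions (`hasLaplacian_mode`). Finally the modes are total
(`ae_eq_zero_of_integral_sin_mul_sin`): multiplication by a cosine only shifts the index of a sine
wave, so Stone–Weierstrass applies to the algebra of the cosines; triangles reduce to squares by
reflection. -/

/-! ### The abstract Cauchy problem for a diagonalizable closed relation -/

section SpectralFlow

variable {H : Type*} [NormedAddCommGroup H] [InnerProductSpace ℝ H] [CompleteSpace H]

/-- An orthogonal family of nonzero vectors whose orthogonal complement is trivial becomes a
Hilbert basis after normalization. -/
theorem exists_hilbertBasis_of_orthogonal {ι : Type*} {v : ι → H}
    (hv : Pairwise fun i j => inner ℝ (v i) (v j) = 0) (hv0 : ∀ i, v i ≠ 0)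
    (htot : ∀ x, (∀ i, inner ℝ (v i) x = 0) → x = 0) :
    ∃ b : HilbertBasis ι ℝ H, ∀ i, b i = ‖v i‖⁻¹ • v i := by
  have hon : Orthonormal ℝ (fun i => ‖v i‖⁻¹ • v i) := by
    refine ⟨fun i => ?_, fun i j hij => ?_⟩
    · rw [norm_smul, norm_inv, norm_norm, inv_mul_cancel₀ (norm_ne_zero_iff.2 (hv0 i))]
    · simp [inner_smul_left, inner_smul_right, hv hij]
  have hbot : (Submodule.span ℝ (Set.range fun i => ‖v i‖⁻¹ • v i))ᗮ = ⊥ := by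
    refine (Submodule.eq_bot_iff _).2 fun x hx => htot x fun i => ?_
    have h := Submodule.inner_right_of_mem_orthogonal
      (Submodule.subset_span (Set.mem_range_self i)) hx
    rw [inner_smul_left] at h
    rcases mul_eq_zero.1 h with h | h
    · simp [hv0 i] at h
    · exact h
  exact ⟨HilbertBasis.mkOfOrthogonalEqBot hon hbot, fun i => by simp⟩

/-- The diagonal semigroup attached to a Hilbert basis of eigenvectors of a closed linear relation
solves the abstract Cauchy problem. -/
theorem exists_flow_of_hilbertBasis {ι : Type*} (L : Submodule ℝ (H × H))
    (hL : IsClosed (L : Set (H × H))) (b : HilbertBasis ι ℝ H) (l : ι → ℝ) (hl : ∀ i, 0 ≤ l i)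
    (hsum : ∀ s : ℝ, 0 < s → Summable fun i => Real.exp (-(l i * s)))
    (heig : ∀ i, (b i, -l i • b i) ∈ L) (g : H) :
    ∃ u : ℝ → H, u 0 = g ∧ Tendsto u (𝓝[>] 0) (𝓝 (u 0)) ∧
      (∀ t, 0 < t → ∃ f, HasDerivAt u f t ∧ (u t, f) ∈ L) ∧
      ∀ t, 0 < t → HasSum (fun i => Real.exp (-(l i * t)) * inner ℝ (b i) g ^ 2)
        (inner ℝ g (u t)) := by
  set c : ι → ℝ := fun i => inner ℝ (b i) g with hc
  have hcg : ∀ i, |c i| ≤ ‖g‖ := fun i => by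
    have := abs_real_inner_le_norm (b i) g
    rwa [b.orthonormal.1 i, one_mul] at this
  have hrepr : HasSum (fun i => c i • b i) g := by
    simpa only [HilbertBasis.repr_apply_apply] using b.hasSum_repr g
  set F : ι → ℝ → H := fun i t => (Real.exp (-(l i * t)) * c i) • b i with hF
  set F' : ι → ℝ → H := fun i t => (-l i * (Real.exp (-(l i * t)) * c i)) • b i with hF'
  set u : ℝ → H := fun t => ∑' i, F i t with hu
  have hnF : ∀ i t, ‖F i t‖ ≤ Real.exp (-(l i * t)) * ‖g‖ := fun i t => by
    rw [hF, norm_smul, b.orthonormal.1 i, mul_one, Real.norm_eq_abs, abs_mul, Real.abs_exp]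
    exact mul_le_mul_of_nonneg_left (hcg i) (Real.exp_pos _).le
  have hsF : ∀ t, 0 < t → Summable fun i => F i t := fun t ht =>
    Summable.of_norm_bounded ((hsum t ht).mul_right ‖g‖) fun i => hnF i t
  -- For s > t/2 the factor exp(-ls) is at most exp(-lt/4)². One copy absorbs the factor l, since x
  -- ≤ exp x gives l exp(-lt/4) ≤ 4/t; the other keeps the series summable. This is the uniform
  -- bound needed to differentiate termwise near t.
  have hb : ∀ t, 0 < t → Summable fun i => 4 / t * Real.exp (-(l i * (t / 4))) * ‖g‖ := fun t ht =>
    ((hsum (t / 4) (by positivity)).mul_left _).mul_right _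
  have hnF' : ∀ t, 0 < t → ∀ i, ∀ s ∈ Set.Ioi (t / 2),
      ‖F' i s‖ ≤ 4 / t * Real.exp (-(l i * (t / 4))) * ‖g‖ := fun t ht i s hs => by
    rw [hF', norm_smul, b.orthonormal.1 i, mul_one, Real.norm_eq_abs, abs_mul, abs_mul,
      Real.abs_exp, abs_neg, abs_of_nonneg (hl i), ← mul_assoc]
    refine mul_le_mul ?_ (hcg i) (abs_nonneg _) (by positivity)
    have h1 : Real.exp (-(l i * s)) ≤ Real.exp (-(l i * (t / 4))) * Real.exp (-(l i * (t / 4))) := by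
      rw [← Real.exp_add]
      refine Real.exp_le_exp.2 ?_
      have : l i * (t / 2) ≤ l i * s := mul_le_mul_of_nonneg_left (le_of_lt hs) (hl i)
      linarith
    have h2 : l i * Real.exp (-(l i * (t / 4))) ≤ 4 / t := by
      have h3 : l i * (t / 4) ≤ Real.exp (l i * (t / 4)) := by
        linarith [Real.add_one_le_exp (l i * (t / 4))]
      rw [Real.exp_neg, ← div_eq_mul_inv, div_le_div_iff₀ (Real.exp_pos _) ht]
      linarith
    calc l i * Real.exp (-(l i * s))
        ≤ l i * (Real.exp (-(l i * (t / 4))) * Real.exp (-(l i * (t / 4)))) :=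
          mul_le_mul_of_nonneg_left h1 (hl i)
      _ = l i * Real.exp (-(l i * (t / 4))) * Real.exp (-(l i * (t / 4))) := by ring
      _ ≤ _ := mul_le_mul_of_nonneg_right h2 (Real.exp_pos _).le
  have hderiv : ∀ t, 0 < t → HasDerivAt u (∑' i, F' i t) t := fun t ht => by
    refine hasDerivAt_tsum_of_isPreconnected (hb t ht) isOpen_Ioi isPreconnected_Ioi
      (fun i s _ => ?_) (hnF' t ht) (y₀ := t) (by simp [ht]) (hsF t ht) (by simp [ht])
    have h1 : HasDerivAt (fun y : ℝ => -(l i * y)) (-l i) s := by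
      simpa using (hasDerivAt_id s).const_mul (-l i)
    have h2 := ((h1.exp).mul_const (c i)).smul_const (b i)
    simp only [hF']
    convert h2 using 2
    ring
  have hu0 : u 0 = g := by
    simpa [hu, hF] using hrepr.tsum_eq
  have hinner : ∀ t, 0 < t → HasSum (fun i => Real.exp (-(l i * t)) * c i ^ 2)
      (inner ℝ g (u t)) := fun t ht => by
    have h := (hsF t ht).hasSum.mapL (innerSL ℝ g)
    have he : (fun i => Real.exp (-(l i * t)) * c i ^ 2) =
        fun i => innerSL ℝ g (F i t) := by
      funext i
      simp only [hF, innerSL_apply_apply, inner_smul_right, hc, real_inner_comm g]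
      ring
    rwa [he]
  have hcoef : ∀ t, 0 < t → ∀ i, inner ℝ (b i) (u t) = Real.exp (-(l i * t)) * c i := by
    intro t ht i
    have h := (hsF t ht).hasSum.mapL (innerSL ℝ (b i))
    have h2 := hasSum_single (f := fun j => innerSL ℝ (b i) (F j t)) i (fun j hj => by
      simp [hF, b.orthonormal.2 hj.symm])
    have h3 := h.unique h2
    simpa [hF, inner_smul_right, b.orthonormal.1 i] using h3
  refine ⟨u, hu0, ?_, fun t ht => ⟨_, hderiv t ht, ?_⟩, hinner⟩
  · rw [hu0, tendsto_iff_norm_sub_tendsto_zero]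
    -- The norm bounds above degenerate as t ↓ 0, so continuity at 0 uses Parseval instead, with the
    -- dominating series ∑ c i ^ 2.
    have hkey : ∀ t, 0 < t → ‖u t - g‖ ^ 2 = ∑' i, (Real.exp (-(l i * t)) - 1) ^ 2 * c i ^ 2 := by
      intro t ht
      rw [← real_inner_self_eq_norm_sq, ← b.tsum_inner_mul_inner]
      refine tsum_congr fun i => ?_
      rw [real_inner_comm, inner_sub_right, hcoef t ht]
      simp only [hc]
      ring
    have hsc : Summable fun i => c i ^ 2 := by
      have := b.summable_inner_mul_inner g g
      refine this.congr fun i => ?_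
      simp only [hc]
      rw [real_inner_comm, sq]
    have hlim : Tendsto (fun t : ℝ => ∑' i, (Real.exp (-(l i * t)) - 1) ^ 2 * c i ^ 2) (𝓝[>] 0)
        (𝓝 (∑' i : ι, 0)) := by
      refine tendsto_tsum_of_dominated_convergence hsc (fun i => ?_) ?_
      · have h : Continuous fun t : ℝ => (Real.exp (-(l i * t)) - 1) ^ 2 * c i ^ 2 := by fun_prop
        have h0 := (h.tendsto 0).mono_left (nhdsWithin_le_nhds (s := Set.Ioi 0))
        simpa using h0
      · filter_upwards [self_mem_nhdsWithin] with t ht i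
        have ht : 0 < t := ht
        rw [Real.norm_eq_abs, abs_of_nonneg (by positivity)]
        refine mul_le_of_le_one_left (sq_nonneg _) ?_
        have h1 : Real.exp (-(l i * t)) ≤ 1 :=
          Real.exp_le_one_iff.2 (by have := mul_nonneg (hl i) ht.le; linarith)
        have h2 := Real.exp_pos (-(l i * t))
        nlinarith
    have hsq : Tendsto (fun t => ‖u t - g‖ ^ 2) (𝓝[>] 0) (𝓝 0) := by
      rw [tsum_zero] at hlim
      refine hlim.congr' ?_
      filter_upwards [self_mem_nhdsWithin] with t ht
      exact (hkey t ht).symm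
    have := hsq.sqrt
    simpa [Real.sqrt_sq (norm_nonneg _)] using this
  · have hsF' : Summable fun i => F' i t :=
      Summable.of_norm_bounded (hb t ht) fun i => hnF' t ht i t (by simp [ht])
    -- Partial sums of the pair of series are combinations of eigenpairs, hence lie in L; closedness
    -- of L passes this to the limit.
    have h := (hsF t ht).hasSum.prodMk hsF'.hasSum
    refine hL.mem_of_tendsto h (Eventually.of_forall fun s => L.sum_mem fun i _ => ?_)
    have := L.smul_mem (Real.exp (-(l i * t)) * c i) (heig i)
    convert this using 1
    simp only [hF, hF', Prod.smul_mk, smul_smul]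
    congr 2
    ring

/-- Existence for the abstract Cauchy problem of a closed linear relation possessing a total
orthogonal family of eigenvectors. -/
theorem exists_flow_of_orthogonal {ι : Type*} (L : Submodule ℝ (H × H))
    (hL : IsClosed (L : Set (H × H))) {v : ι → H}
    (hv : Pairwise fun i j => inner ℝ (v i) (v j) = 0) (hv0 : ∀ i, v i ≠ 0)
    (htot : ∀ x, (∀ i, inner ℝ (v i) x = 0) → x = 0) (l : ι → ℝ) (hl : ∀ i, 0 ≤ l i)
    (hsum : ∀ s : ℝ, 0 < s → Summable fun i => Real.exp (-(l i * s)))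
    (heig : ∀ i, (v i, -l i • v i) ∈ L) (g : H) :
    ∃ u : ℝ → H, u 0 = g ∧ Tendsto u (𝓝[>] 0) (𝓝 (u 0)) ∧
      (∀ t, 0 < t → ∃ f, HasDerivAt u f t ∧ (u t, f) ∈ L) ∧
      (∀ t, 0 < t → HasSum (fun i => Real.exp (-(l i * t)) * (inner ℝ (v i) g ^ 2 / ‖v i‖ ^ 2))
        (inner ℝ g (u t))) ∧
      HasSum (fun i => inner ℝ (v i) g ^ 2 / ‖v i‖ ^ 2) (‖g‖ ^ 2) := by
  obtain ⟨b, hb⟩ := exists_hilbertBasis_of_orthogonal hv hv0 htot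
  have hbi : ∀ i, inner ℝ (b i) g ^ 2 = inner ℝ (v i) g ^ 2 / ‖v i‖ ^ 2 := fun i => by
    rw [hb, inner_smul_left]
    simp [mul_pow, div_eq_inv_mul]
  obtain ⟨u, h0, h1, h2, h3⟩ := exists_flow_of_hilbertBasis L hL b l hl hsum (fun i => by
    have := L.smul_mem ‖v i‖⁻¹ (heig i)
    rwa [Prod.smul_mk, smul_comm, ← hb] at this) g
  refine ⟨u, h0, h1, h2, fun t ht => by simpa only [hbi] using h3 t ht, ?_⟩
  have h := b.hasSum_inner_mul_inner g g
  rw [real_inner_self_eq_norm_sq] at h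
  have he : (fun i => inner ℝ (v i) g ^ 2 / ‖v i‖ ^ 2) =
      fun i => inner ℝ g (b i) * inner ℝ (b i) g := by
    funext i
    rw [← hbi, real_inner_comm g, sq]
  rwa [he]

end SpectralFlow

/-! ### The form domain, the Laplacian as a closed relation, and uniqueness -/

theorem tsupport_add_subset {X : Type*} [TopologicalSpace X] (f g : X → ℝ) :
    tsupport (fun p => f p + g p) ⊆ tsupport f ∪ tsupport g := by
  refine closure_minimal (fun p hp => ?_) ((isClosed_tsupport f).union (isClosed_tsupport g))
  by_contra h
  simp only [Set.mem_union, not_or] at h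
  exact hp (by simp [image_eq_zero_of_notMem_tsupport h.1, image_eq_zero_of_notMem_tsupport h.2])

theorem MeasureTheory.L2.real_inner_eq_integral_mul {α : Type*} [MeasurableSpace α] {μ : Measure α}
    (f g : Lp ℝ 2 μ) : inner ℝ f g = ∫ p, f p * g p ∂μ := by
  rw [L2.inner_def]
  simp [mul_comm]

namespace MixedDomain

variable {P : MixedDomain}

theorem isFiniteMeasure_of_isBounded (hP : Bornology.IsBounded P.carrier) :
    IsFiniteMeasure P.measure :=
  ⟨by simpa using hP.measure_lt_top⟩

theorem memLp_of_continuous (hP : Bornology.IsBounded P.carrier) {φ : ℝ × ℝ → ℝ}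
    (hφ : Continuous φ) (q : ℝ≥0∞) : MemLp φ q P.measure := by
  have hK : IsCompact (closure P.carrier) := hP.isCompact_closure
  obtain ⟨C, hC⟩ := hK.exists_bound_of_continuousOn hφ.continuousOn
  have : IsFiniteMeasure (volume.restrict (closure P.carrier)) :=
    ⟨by simpa using hK.measure_lt_top⟩
  refine MemLp.mono_measure (Measure.restrict_mono subset_closure le_rfl)
    (MemLp.of_bound hφ.aestronglyMeasurable C ?_)
  exact ae_restrict_of_forall_mem isClosed_closure.measurableSet hC

/-- The class in `L²` of a continuous function. -/
noncomputable def toL2 (hP : Bornology.IsBounded P.carrier) (φ : ℝ × ℝ → ℝ)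
    (hφ : Continuous φ) : P.L2 :=
  (memLp_of_continuous hP hφ 2).toLp φ

theorem coeFn_toL2 (hP : Bornology.IsBounded P.carrier) {φ : ℝ × ℝ → ℝ} (hφ : Continuous φ) :
    toL2 hP φ hφ =ᵐ[P.measure] φ :=
  MemLp.coeFn_toLp _

theorem continuous_fderiv_apply {φ : ℝ × ℝ → ℝ} (hφ : ContDiff ℝ ∞ φ) (v : ℝ × ℝ) :
    Continuous fun p => fderiv ℝ φ p v :=
  (hφ.continuous_fderiv (by simp)).clm_apply continuous_const

/-- The graph of the gradient on the smooth functions vanishing near the Dirichlet part. -/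
def testGraph (P : MixedDomain) : Submodule ℝ (P.L2 × P.L2 × P.L2) where
  carrier := {z | ∃ φ : ℝ × ℝ → ℝ, (ContDiff ℝ ∞ φ ∧ Disjoint (tsupport φ) P.dirichlet) ∧
    z.1 =ᵐ[P.measure] φ ∧ z.2.1 =ᵐ[P.measure] (fun p => fderiv ℝ φ p (1, 0)) ∧
    z.2.2 =ᵐ[P.measure] fun p => fderiv ℝ φ p (0, 1)}
  add_mem' := by
    rintro ⟨a, b, c⟩ ⟨a', b', c'⟩ ⟨φ, ⟨h1, h2⟩, ha, hb, hc⟩ ⟨φ', ⟨h1', h2'⟩, ha', hb', hc'⟩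
    have hd : ∀ p, fderiv ℝ (fun p => φ p + φ' p) p = fderiv ℝ φ p + fderiv ℝ φ' p := fun p =>
      fderiv_fun_add (h1.differentiable (by simp) p) (h1'.differentiable (by simp) p)
    refine ⟨fun p => φ p + φ' p, ⟨h1.add h1', ?_⟩, ?_, ?_, ?_⟩
    · exact (Disjoint.union_left h2 h2').mono_left (tsupport_add_subset φ φ')
    · exact (Lp.coeFn_add a a').trans (ha.add ha')
    · simp only [hd]
      exact (Lp.coeFn_add b b').trans (hb.add hb')
    · simp only [hd]
      exact (Lp.coeFn_add c c').trans (hc.add hc')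
  zero_mem' := by
    refine ⟨fun _ => 0, ⟨contDiff_const, by simp [tsupport, Function.support]⟩, ?_, ?_, ?_⟩
    · exact Lp.coeFn_zero _ _ _
    · simp only [fderiv_fun_const]
      exact Lp.coeFn_zero _ _ _
    · simp only [fderiv_fun_const]
      exact Lp.coeFn_zero _ _ _
  smul_mem' := by
    rintro r ⟨a, b, c⟩ ⟨φ, ⟨h1, h2⟩, ha, hb, hc⟩
    have hd : ∀ p, fderiv ℝ (fun p => r * φ p) p = r • fderiv ℝ φ p := fun p =>
      fderiv_const_mul (h1.differentiable (by simp) p) r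
    refine ⟨fun p => r * φ p, ⟨contDiff_const.mul h1, h2.mono_left tsupport_mul_subset_right⟩,
      ?_, ?_, ?_⟩
    · exact (Lp.coeFn_smul r a).trans (ha.const_smul r)
    · simp only [hd]
      exact (Lp.coeFn_smul r b).trans (hb.const_smul r)
    · simp only [hd]
      exact (Lp.coeFn_smul r c).trans (hc.const_smul r)

/-- Replaces the defining sequences by membership in a closed submodule, after which linearity and
passage to limits need no approximating functions. -/
theorem hasGrad_iff_mem_closure (hP : Bornology.IsBounded P.carrier) (w gx gy : P.L2) :
    P.HasGrad w gx gy ↔ (w, gx, gy) ∈ P.testGraph.topologicalClosure := by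
  rw [← SetLike.mem_coe, Submodule.topologicalClosure_coe, mem_closure_iff_seq_limit]
  have key : ∀ (f : ℕ → ℝ × ℝ → ℝ) (F : ℕ → P.L2) (g : P.L2), (∀ n, F n =ᵐ[P.measure] f n) →
      (Tendsto F atTop (𝓝 g) ↔
        Tendsto (fun n => eLpNorm (fun p => f n p - g p) 2 P.measure) atTop (𝓝 0)) := by
    intro f F g hF
    rw [Lp.tendsto_Lp_iff_tendsto_eLpNorm']
    refine tendsto_congr fun n => eLpNorm_congr_ae ?_
    filter_upwards [hF n] with p hp
    simp [hp]
  constructor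
  · rintro ⟨φ, hφ, h0, h1, h2⟩
    have c0 := fun n => (hφ n).1.continuous
    have c1 := fun n => continuous_fderiv_apply (hφ n).1 (1, 0)
    have c2 := fun n => continuous_fderiv_apply (hφ n).1 (0, 1)
    refine ⟨fun n => (toL2 hP _ (c0 n), toL2 hP _ (c1 n), toL2 hP _ (c2 n)),
      fun n => ⟨φ n, hφ n, coeFn_toL2 hP (c0 n), coeFn_toL2 hP (c1 n), coeFn_toL2 hP (c2 n)⟩, ?_⟩
    exact ((key _ _ _ fun n => coeFn_toL2 hP (c0 n)).2 h0).prodMk_nhds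
      (((key _ _ _ fun n => coeFn_toL2 hP (c1 n)).2 h1).prodMk_nhds
        ((key _ _ _ fun n => coeFn_toL2 hP (c2 n)).2 h2))
  · rintro ⟨z, hz, hlim⟩
    choose φ hφ h0 h1 h2 using hz
    have l0 := (continuous_fst.tendsto _).comp hlim
    have l1 := ((continuous_fst.comp continuous_snd).tendsto _).comp hlim
    have l2 := ((continuous_snd.comp continuous_snd).tendsto _).comp hlim
    exact ⟨φ, hφ, (key _ _ _ h0).1 l0, (key _ _ _ h1).1 l1, (key _ _ _ h2).1 l2⟩

/-- Green's formula in terms of the inner product of `L²`. -/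
theorem green_iff (gx gy hx hy f v : P.L2) :
    ∫ p, (gx p * hx p + gy p * hy p) ∂P.measure = -∫ p, f p * v p ∂P.measure ↔
      inner ℝ gx hx + inner ℝ gy hy = -inner ℝ f v := by
  have hi : ∀ a b : P.L2, Integrable (fun p => a p * b p) P.measure := fun a b => by
    simpa [mul_comm] using L2.integrable_inner (𝕜 := ℝ) a b
  rw [integral_add (hi _ _) (hi _ _), L2.real_inner_eq_integral_mul,
    L2.real_inner_eq_integral_mul, L2.real_inner_eq_integral_mul]

theorem hasLaplacian_iff (hP : Bornology.IsBounded P.carrier) (w f : P.L2) :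
    P.HasLaplacian w f ↔ ∃ g : P.L2 × P.L2, (w, g) ∈ P.testGraph.topologicalClosure ∧
      ∀ z ∈ P.testGraph.topologicalClosure,
        inner ℝ g.1 z.2.1 + inner ℝ g.2 z.2.2 = -inner ℝ f z.1 := by
  simp only [HasLaplacian, green_iff, hasGrad_iff_mem_closure hP]
  constructor
  · rintro ⟨gx, gy, h, h'⟩
    exact ⟨(gx, gy), h, fun z hz => h' _ _ _ hz⟩
  · rintro ⟨g, h, h'⟩
    exact ⟨g.1, g.2, h, fun v hx hy hv => h' _ hv⟩

/-- The graph of the Laplacian with mixed boundary conditions. -/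
def laplacianGraph (hP : Bornology.IsBounded P.carrier) : Submodule ℝ (P.L2 × P.L2) where
  carrier := {z | P.HasLaplacian z.1 z.2}
  add_mem' := by
    rintro ⟨w, f⟩ ⟨w', f'⟩ h h'
    obtain ⟨g, hg, hv⟩ := (hasLaplacian_iff hP _ _).1 h
    obtain ⟨g', hg', hv'⟩ := (hasLaplacian_iff hP _ _).1 h'
    refine (hasLaplacian_iff hP _ _).2 ⟨g + g', Submodule.add_mem _ hg hg', fun z hz => ?_⟩
    have e := hv z hz
    have e' := hv' z hz
    simp only [Prod.fst_add, Prod.snd_add, inner_add_left] at e e' ⊢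
    linarith
  zero_mem' := by
    refine (hasLaplacian_iff hP _ _).2 ⟨0, Submodule.zero_mem _, fun z hz => ?_⟩
    simp
  smul_mem' := by
    rintro r ⟨w, f⟩ h
    obtain ⟨g, hg, hv⟩ := (hasLaplacian_iff hP _ _).1 h
    refine (hasLaplacian_iff hP _ _).2 ⟨r • g, Submodule.smul_mem _ r hg, fun z hz => ?_⟩
    have e := hv z hz
    simp only [Prod.smul_fst, Prod.smul_snd, inner_smul_left, conj_trivial] at e ⊢
    linear_combination r * e

/-- Testing the difference of two Green identities with the difference of the two functions bounds
the squared distance of the gradients by ‖f_m - f_n‖ ‖w_m - w_n‖. So convergence of w and f forces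
convergence of the gradients, and Green's formula survives in the limit. -/
theorem isClosed_laplacianGraph (hP : Bornology.IsBounded P.carrier) :
    IsClosed (laplacianGraph hP : Set (P.L2 × P.L2)) := by
  refine isClosed_of_closure_subset fun z hz => ?_
  obtain ⟨s, hs, hlim⟩ := mem_closure_iff_seq_limit.1 hz
  choose g hg hv using fun n => (hasLaplacian_iff hP _ _).1 (hs n)
  have l0 : Tendsto (fun n => (s n).1) atTop (𝓝 z.1) := (continuous_fst.tendsto _).comp hlim
  have l1 : Tendsto (fun n => (s n).2) atTop (𝓝 z.2) := (continuous_snd.tendsto _).comp hlim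
  have hen : ∀ m n, ‖(g m).1 - (g n).1‖ ^ 2 + ‖(g m).2 - (g n).2‖ ^ 2
      ≤ ‖(s m).2 - (s n).2‖ * ‖(s m).1 - (s n).1‖ := by
    intro m n
    have hd := Submodule.sub_mem _ (hg m) (hg n)
    have e1 := hv m _ hd
    have e2 := hv n _ hd
    simp only [Prod.fst_sub, Prod.snd_sub] at e1 e2
    have e3 := (abs_real_inner_le_norm ((s m).2 - (s n).2) ((s m).1 - (s n).1))
    have e4 := (abs_le.1 e3).1
    rw [← real_inner_self_eq_norm_sq, ← real_inner_self_eq_norm_sq, inner_sub_left (𝕜 := ℝ) (g m).1,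
      inner_sub_left (𝕜 := ℝ) (g m).2]
    rw [inner_sub_left] at e4
    linarith
  have hc0 := l0.cauchySeq
  have hc1 := l1.cauchySeq
  have hprod : Tendsto (fun k : ℕ × ℕ => ‖(s k.1).2 - (s k.2).2‖ * ‖(s k.1).1 - (s k.2).1‖) atTop
      (𝓝 0) := by
    have a0 := cauchySeq_iff_tendsto_dist_atTop_0.1 hc0
    have a1 := cauchySeq_iff_tendsto_dist_atTop_0.1 hc1
    simpa [dist_eq_norm] using a1.mul a0
  have hsqrt := hprod.sqrt
  rw [Real.sqrt_zero] at hsqrt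
  have hcg1 : CauchySeq fun n => (g n).1 := by
    rw [cauchySeq_iff_tendsto_dist_atTop_0]
    refine squeeze_zero (fun _ => dist_nonneg) (fun k => ?_) hsqrt
    rw [dist_eq_norm]
    refine Real.le_sqrt_of_sq_le ?_
    linarith [hen k.1 k.2, sq_nonneg ‖(g k.1).2 - (g k.2).2‖]
  have hcg2 : CauchySeq fun n => (g n).2 := by
    rw [cauchySeq_iff_tendsto_dist_atTop_0]
    refine squeeze_zero (fun _ => dist_nonneg) (fun k => ?_) hsqrt
    rw [dist_eq_norm]
    refine Real.le_sqrt_of_sq_le ?_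
    linarith [hen k.1 k.2, sq_nonneg ‖(g k.1).1 - (g k.2).1‖]
  obtain ⟨gx, hgx⟩ := cauchySeq_tendsto_of_complete hcg1
  obtain ⟨gy, hgy⟩ := cauchySeq_tendsto_of_complete hcg2
  refine (hasLaplacian_iff hP _ _).2 ⟨(gx, gy), ?_, fun v hvv => ?_⟩
  · exact P.testGraph.isClosed_topologicalClosure.mem_of_tendsto
      (l0.prodMk_nhds (hgx.prodMk_nhds hgy)) (Eventually.of_forall hg)
  · refine tendsto_nhds_unique ((hgx.inner tendsto_const_nhds).add (hgy.inner tendsto_const_nhds))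
      ?_
    refine Tendsto.congr (fun n => (hv n v hvv).symm) ?_
    exact (l1.inner tendsto_const_nhds).neg

/-- Green's formula tested with w itself: the pairing is minus the Dirichlet energy. -/
theorem HasLaplacian.inner_nonpos (hP : Bornology.IsBounded P.carrier) {w f : P.L2}
    (h : P.HasLaplacian w f) : inner ℝ w f ≤ 0 := by
  obtain ⟨g, hg, hv⟩ := (hasLaplacian_iff hP _ _).1 h
  have e := hv _ hg
  rw [real_inner_comm]
  simp only [real_inner_self_eq_norm_sq] at e
  nlinarith [sq_nonneg ‖g.1‖, sq_nonneg ‖g.2‖]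

/-- Uniqueness for the heat problem, by the energy method. -/
theorem IsHeatFlow.eq_of_nonneg (hP : Bornology.IsBounded P.carrier) {u v : ℝ → P.L2}
    (hu : P.IsHeatFlow u) (hv : P.IsHeatFlow v) {t : ℝ} (ht : 0 ≤ t) : u t = v t := by
  obtain ⟨hu0, hul, hud⟩ := hu
  obtain ⟨hv0, hvl, hvd⟩ := hv
  have h0 : u 0 = v 0 := by
    refine Lp.ext ?_
    filter_upwards [hu0, hv0] with p h1 h2
    rw [h1, h2]
  set w : ℝ → P.L2 := fun t => u t - v t with hw
  have hwd : ∀ t, 0 < t → ∃ d ≤ 0, HasDerivAt (fun t => ‖w t‖ ^ 2) d t := by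
    intro t ht
    obtain ⟨f, hf, hfL⟩ := hud t ht
    obtain ⟨f', hf', hfL'⟩ := hvd t ht
    have hL : P.HasLaplacian (w t) (f - f') :=
      (laplacianGraph hP).sub_mem (x := (u t, f)) (y := (v t, f')) hfL hfL'
    refine ⟨_, ?_, (hf.sub hf').norm_sq⟩
    have := hL.inner_nonpos hP
    simp only [hw] at this
    simp only [Pi.sub_apply]
    linarith
  have hcont : ContinuousOn (fun t => ‖w t‖ ^ 2) (Set.Ici 0) := by
    intro t ht
    rcases eq_or_lt_of_le (show (0 : ℝ) ≤ t from ht) with rfl | ht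
    -- At time 0 no derivative is available; continuity there is the attainment of the initial
    -- datum.
    · have h : Tendsto (fun t => ‖w t‖ ^ 2) (𝓝[>] 0) (𝓝 (‖w 0‖ ^ 2)) := ((hul.sub hvl).norm).pow 2
      have h' : ContinuousWithinAt (fun t => ‖w t‖ ^ 2) (Set.Ioi 0) 0 := h
      exact continuousWithinAt_Ioi_iff_Ici.1 h'
    · obtain ⟨d, -, hd⟩ := hwd t ht
      exact hd.continuousAt.continuousWithinAt
  have hanti : AntitoneOn (fun t => ‖w t‖ ^ 2) (Set.Ici 0) := by
    refine antitoneOn_of_deriv_nonpos (convex_Ici 0) hcont ?_ ?_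
    · intro t ht
      rw [interior_Ici] at ht
      obtain ⟨d, -, hd⟩ := hwd t ht
      exact hd.differentiableAt.differentiableWithinAt
    · intro t ht
      rw [interior_Ici] at ht
      obtain ⟨d, hd0, hd⟩ := hwd t ht
      rwa [hd.deriv]
  have h1 : ‖w t‖ ^ 2 ≤ ‖w 0‖ ^ 2 := hanti (Set.mem_Ici.2 le_rfl) ht ht
  have h2 : w 0 = 0 := by simp [hw, h0]
  rw [h2, norm_zero] at h1
  have h3 : w t = 0 := by
    rw [← norm_eq_zero]
    nlinarith [norm_nonneg (w t)]
  exact sub_eq_zero.1 h3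

end MixedDomain

/-! ### Smooth functions vanishing on the Dirichlet part belong to the form domain -/

/-- The zeros of a real function at which its derivative does not vanish form a null set. -/
theorem ae_deriv_eq_zero_of_eq_zero {f f' : ℝ → ℝ} (hf : ∀ x, HasDerivAt f (f' x) x) :
    ∀ᵐ x : ℝ, f x = 0 → f' x = 0 := by
  set s : Set ℝ := {x | f x = 0 ∧ f' x ≠ 0} with hs
  have hc : s.Countable := by
    -- A zero with nonvanishing derivative is isolated among the zeros, and a set has only countably
    -- many points that are isolated from the right in it.
    refine Set.Countable.mono (fun x hx => ?_)
      (countable_setOfPred_isolated_right_within (s := s))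
    refine ⟨hx, ?_⟩
    have h := (hf x).eventually_ne (c := 0) hx.2
    rw [← empty_mem_iff_bot]
    have h1 : 𝓝[s ∩ Set.Ioi x] x ≤ 𝓝[≠] x :=
      nhdsWithin_mono _ fun y hy => ne_of_gt hy.2
    filter_upwards [h1 h, self_mem_nhdsWithin] with y hy hys
    exact hy hys.1.1
  filter_upwards [compl_mem_ae_iff.2 (hc.measure_zero volume)] with x hx h0
  by_contra h
  exact hx ⟨h0, h⟩

theorem hasDerivAt_fst_of_differentiable {φ : ℝ × ℝ → ℝ} (hφ : Differentiable ℝ φ) (x y : ℝ) :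
    HasDerivAt (fun x => φ (x, y)) (fderiv ℝ φ (x, y) (1, 0)) x :=
  (hφ (x, y)).hasFDerivAt.comp_hasDerivAt x ((hasDerivAt_id x).prodMk (hasDerivAt_const x y))

theorem hasDerivAt_snd_of_differentiable {φ : ℝ × ℝ → ℝ} (hφ : Differentiable ℝ φ) (x y : ℝ) :
    HasDerivAt (fun y => φ (x, y)) (fderiv ℝ φ (x, y) (0, 1)) y :=
  (hφ (x, y)).hasFDerivAt.comp_hasDerivAt y ((hasDerivAt_const y x).prodMk (hasDerivAt_id y))

/-- The one-dimensional fact on each horizontal line, assembled by Fubini. It disposes of the zero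
set of ψ when gradients of truncations of ψ are compared with that of ψ. -/
theorem ae_fderiv_fst_eq_zero_of_eq_zero {φ : ℝ × ℝ → ℝ} (hφ : ContDiff ℝ ∞ φ) :
    ∀ᵐ p : ℝ × ℝ, φ p = 0 → fderiv ℝ φ p (1, 0) = 0 := by
  have hm : MeasurableSet {p : ℝ × ℝ | ¬ (φ p = 0 → fderiv ℝ φ p (1, 0) = 0)} := by
    have h1 := (isClosed_singleton (x := (0 : ℝ))).preimage hφ.continuous
    have h2 := (isClosed_singleton (x := (0 : ℝ))).preimage
      (MixedDomain.continuous_fderiv_apply hφ (1, 0))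
    convert h1.measurableSet.diff h2.measurableSet using 1
    ext p
    simp
  rw [ae_iff, Measure.volume_eq_prod, Measure.prod_apply_symm hm, lintegral_eq_zero_iff
    (measurable_measure_prodMk_right hm)]
  refine Eventually.of_forall fun y => ?_
  exact ae_iff.1 (ae_deriv_eq_zero_of_eq_zero fun x =>
    hasDerivAt_fst_of_differentiable (hφ.differentiable (by simp)) x y)

theorem ae_fderiv_snd_eq_zero_of_eq_zero {φ : ℝ × ℝ → ℝ} (hφ : ContDiff ℝ ∞ φ) :
    ∀ᵐ p : ℝ × ℝ, φ p = 0 → fderiv ℝ φ p (0, 1) = 0 := by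
  have hm : MeasurableSet {p : ℝ × ℝ | ¬ (φ p = 0 → fderiv ℝ φ p (0, 1) = 0)} := by
    have h1 := (isClosed_singleton (x := (0 : ℝ))).preimage hφ.continuous
    have h2 := (isClosed_singleton (x := (0 : ℝ))).preimage
      (MixedDomain.continuous_fderiv_apply hφ (0, 1))
    convert h1.measurableSet.diff h2.measurableSet using 1
    ext p
    simp
  rw [ae_iff, Measure.volume_eq_prod, Measure.prod_apply hm, lintegral_eq_zero_iff
    (measurable_measure_prodMk_left hm)]
  refine Eventually.of_forall fun x => ?_
  exact ae_iff.1 (ae_deriv_eq_zero_of_eq_zero fun y =>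
    hasDerivAt_snd_of_differentiable (hφ.differentiable (by simp)) x y)

/-- Bounded convergence in `L²` of a finite measure. -/
theorem tendsto_eLpNorm_two_of_bounded {α : Type*} [MeasurableSpace α] {μ : Measure α}
    [IsFiniteMeasure μ] {f : ℕ → α → ℝ} (hf : ∀ n, AEStronglyMeasurable (f n) μ) (C : ℝ)
    (hC : ∀ n, ∀ᵐ p ∂μ, |f n p| ≤ C) (hlim : ∀ᵐ p ∂μ, Tendsto (fun n => f n p) atTop (𝓝 0)) :
    Tendsto (fun n => eLpNorm (f n) 2 μ) atTop (𝓝 0) := by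
  have h : Tendsto (fun n => ∫⁻ p, ‖f n p‖ₑ ^ (2 : ℝ) ∂μ) atTop (𝓝 (∫⁻ _, 0 ∂μ)) := by
    refine tendsto_lintegral_of_dominated_convergence' (fun _ => ENNReal.ofReal C ^ (2 : ℝ))
      (fun n => (hf n).enorm.pow_const _) (fun n => ?_) ?_ ?_
    · filter_upwards [hC n] with p hp
      refine ENNReal.rpow_le_rpow ?_ (by norm_num)
      rw [Real.enorm_eq_ofReal_abs]
      exact ENNReal.ofReal_le_ofReal hp
    · rw [lintegral_const]
      exact ENNReal.mul_ne_top (ENNReal.rpow_ne_top_of_nonneg (by norm_num) ENNReal.ofReal_ne_top)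
        (measure_ne_top _ _)
    · filter_upwards [hlim] with p hp
      have h1 : Tendsto (fun n => ‖f n p‖ₑ) atTop (𝓝 0) := by simpa using hp.enorm
      have h2 := (ENNReal.continuous_rpow_const (y := 2)).tendsto 0
      rw [ENNReal.zero_rpow_of_pos (by norm_num)] at h2
      exact h2.comp h1
  rw [lintegral_zero] at h
  have h2 := ((ENNReal.continuous_rpow_const (y := 1 / 2)).tendsto 0).comp h
  rw [ENNReal.zero_rpow_of_pos (by norm_num)] at h2
  refine h2.congr fun n => ?_
  rw [eLpNorm_eq_lintegral_rpow_enorm_toReal (by norm_num) (by norm_num)]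
  simp

/-- A smooth function on the line which vanishes near `0`, and equals the identity away
from `0`. -/
theorem exists_smooth_truncation : ∃ h h' : ℝ → ℝ, ContDiff ℝ ∞ h ∧ (∀ s, HasDerivAt h (h' s) s) ∧
    (∀ s, |s| ≤ 1 → h s = 0) ∧ (∀ s, |h s - s| ≤ 2) ∧ (∃ C, ∀ s, |h' s - 1| ≤ C) ∧
    ∀ s, 2 < |s| → h' s = 1 := by
  -- With b equal to 1 for |s| ≤ 1 and to 0 for |s| ≥ 2, the truncation is s (1 - b s).
  let b : ContDiffBump (0 : ℝ) := ⟨1, 2, by norm_num, by norm_num⟩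
  have hb : ContDiff ℝ ∞ b := b.contDiff
  have hh : ContDiff ℝ ∞ fun s => s * (1 - b s) := contDiff_id.mul (contDiff_const.sub hb)
  have hout : ∀ s, 2 < |s| → b s = 0 := fun s hs => b.zero_of_le_dist (by
    simpa [b] using hs.le)
  have hd : ∀ s : ℝ, 2 < |s| → deriv (fun s => s * (1 - b s)) s = 1 := by
    intro s hs
    have he : (fun s => s * (1 - b s)) =ᶠ[𝓝 s] fun s => s := by
      filter_upwards [(isOpen_lt continuous_const continuous_abs).mem_nhds hs] with r hr
      rw [hout r hr]
      ring
    rw [he.deriv_eq, deriv_id'']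
  refine ⟨fun s => s * (1 - b s), deriv fun s => s * (1 - b s), hh,
    fun s => (hh.differentiable (by simp) s).hasDerivAt, fun s hs => ?_, fun s => ?_, ?_, hd⟩
  · have : b s = 1 := b.one_of_mem_closedBall (by simpa [b] using hs)
    simp [this]
  · change |s * (1 - b s) - s| ≤ 2
    rw [show s * (1 - b s) - s = -(s * b s) by ring, abs_neg, abs_mul, abs_of_nonneg b.nonneg]
    rcases le_or_gt |s| 2 with h | h
    · exact (mul_le_of_le_one_right (abs_nonneg _) b.le_one).trans h
    · rw [hout s h, mul_zero]
      norm_num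
  · have hc : Continuous (deriv fun s => s * (1 - b s)) := hh.continuous_deriv (by simp)
    obtain ⟨C, hC⟩ := (isCompact_Icc (a := (-2 : ℝ)) (b := 2)).exists_bound_of_continuousOn
      (hc.sub (continuous_const (y := (1 : ℝ)))).continuousOn
    refine ⟨max C 0, fun s => ?_⟩
    rcases le_or_gt |s| 2 with h | h
    · exact (hC s (abs_le.1 h)).trans (le_max_left _ _)
    · rw [hd s h]
      simp

namespace MixedDomain

variable {P : MixedDomain}

/-- Smooth functions vanishing on the Dirichlet part lie in the form domain, with the classical
gradient. -/
theorem hasGrad_of_contDiff (hP : Bornology.IsBounded P.carrier) {ψ : ℝ × ℝ → ℝ}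
    (hψ : ContDiff ℝ ∞ ψ) (h0 : ∀ p ∈ P.dirichlet, ψ p = 0) :
    P.HasGrad (toL2 hP ψ hψ.continuous) (toL2 hP _ (continuous_fderiv_apply hψ (1, 0)))
      (toL2 hP _ (continuous_fderiv_apply hψ (0, 1))) := by
  have := isFiniteMeasure_of_isBounded hP
  -- The approximants are h(kψ)/k with k = n + 1. They are supported in {|kψ| ≥ 1}, away from the
  -- Dirichlet part, and stay within 2/k of ψ. Their gradient is h'(kψ)∇ψ, which is eventually ∇ψ
  -- where ψ ≠ 0; where ψ = 0 both gradients vanish almost everywhere.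
  obtain ⟨h, h', hh, hder, hz, hbd, ⟨C, hC⟩, h1⟩ := exists_smooth_truncation
  have hn : ∀ n : ℕ, (0 : ℝ) < n + 1 := fun n => by positivity
  have hder' : ∀ (n : ℕ) p v, fderiv ℝ (fun p => h ((n + 1) * ψ p) / (n + 1)) p v =
      h' ((n + 1) * ψ p) * fderiv ℝ ψ p v := by
    intro n p v
    have e1 := ((hψ.differentiable (by simp) p).hasFDerivAt).const_mul ((n : ℝ) + 1)
    have e2 := ((hder ((n + 1) * ψ p)).comp_hasFDerivAt p e1).mul_const ((n : ℝ) + 1)⁻¹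
    have e3 : (fun p => h ((n + 1) * ψ p) / (n + 1)) =
        fun p => (h ∘ fun p => ((n : ℝ) + 1) * ψ p) p * ((n : ℝ) + 1)⁻¹ := by
      funext q
      simp [div_eq_mul_inv]
    rw [e3, e2.fderiv]
    simp only [smul_apply, smul_eq_mul]
    field_simp [(hn n).ne']
  have hsm : ∀ n : ℕ, ContDiff ℝ ∞ fun p => h ((n + 1) * ψ p) / (n + 1) := fun n =>
    (hh.comp (contDiff_const.mul hψ)).div_const _
  have hgrad : ∀ v : ℝ × ℝ, (∀ᵐ p : ℝ × ℝ, ψ p = 0 → fderiv ℝ ψ p v = 0) →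
      Tendsto (fun n : ℕ => eLpNorm (fun p => fderiv ℝ (fun p => h ((n + 1) * ψ p) / (n + 1)) p v -
        toL2 hP _ (continuous_fderiv_apply hψ v) p) 2 P.measure) atTop (𝓝 0) := by
    intro v hv
    obtain ⟨D, hD⟩ := hP.isCompact_closure.exists_bound_of_continuousOn
      (continuous_fderiv_apply hψ v).continuousOn
    have hDae : ∀ᵐ p ∂P.measure, |fderiv ℝ ψ p v| ≤ D :=
      ae_mono (Measure.restrict_mono subset_closure le_rfl)
        (ae_restrict_of_forall_mem isClosed_closure.measurableSet hD)
    have hco := coeFn_toL2 hP (continuous_fderiv_apply hψ v)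
    refine tendsto_eLpNorm_two_of_bounded (fun n => ?_) (C * D) (fun n => ?_) ?_
    · exact (continuous_fderiv_apply (hsm n) v).aestronglyMeasurable.sub
        (Lp.aestronglyMeasurable _)
    · filter_upwards [hDae, hco] with p hp hp2
      rw [hder', hp2, ← sub_one_mul, abs_mul]
      exact mul_le_mul (hC _) hp (abs_nonneg _) ((abs_nonneg _).trans (hC 0))
    · filter_upwards [hco, ae_restrict_of_ae hv] with p hp hp2
      refine tendsto_const_nhds.congr' ?_
      by_cases hp0 : ψ p = 0
      · refine Eventually.of_forall fun n => ?_
        simp only [hder', hp, hp2 hp0]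
        simp
      · have ht : Tendsto (fun n : ℕ => ((n : ℝ) + 1) * |ψ p|) atTop atTop :=
          (tendsto_atTop_add_const_right _ 1 tendsto_natCast_atTop_atTop).atTop_mul_const
            (abs_pos.2 hp0)
        filter_upwards [ht.eventually_gt_atTop 2] with n hn2
        simp only [hder', hp]
        rw [h1 _ (by rwa [abs_mul, abs_of_pos (hn n)])]
        ring
  refine ⟨fun n p => h ((n + 1) * ψ p) / (n + 1), fun n => ⟨hsm n, ?_⟩, ?_,
    hgrad _ (ae_fderiv_fst_eq_zero_of_eq_zero hψ), hgrad _ (ae_fderiv_snd_eq_zero_of_eq_zero hψ)⟩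
  · have hsub : tsupport (fun p => h ((n + 1) * ψ p) / (n + 1)) ⊆ {p | 1 ≤ |(n + 1) * ψ p|} := by
      refine closure_minimal (fun p hp => ?_)
        (isClosed_le continuous_const (continuous_const.mul hψ.continuous).abs)
      by_contra hlt
      exact hp (by simp [hz _ (not_le.1 hlt).le])
    refine Set.disjoint_left.2 fun p hp hpd => ?_
    have := hsub hp
    simp only [Set.mem_ofPred_eq, h0 p hpd] at this
    norm_num at this
  · have hco := coeFn_toL2 hP hψ.continuous
    have hbound : ∀ (n : ℕ) p, |h ((n + 1) * ψ p) / (n + 1) - ψ p| ≤ 2 / (n + 1) := by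
      intro n p
      have : h ((n + 1) * ψ p) / (n + 1) - ψ p = (h ((n + 1) * ψ p) - (n + 1) * ψ p) / (n + 1) := by
        field_simp [(hn n).ne']
      rw [this, abs_div, abs_of_pos (hn n)]
      exact div_le_div_of_nonneg_right (hbd _) (hn n).le
    refine tendsto_eLpNorm_two_of_bounded (fun n => ?_) 2 (fun n => ?_) ?_
    · exact (hsm n).continuous.aestronglyMeasurable.sub (Lp.aestronglyMeasurable _)
    · filter_upwards [hco] with p hp
      rw [hp]
      refine (hbound n p).trans (div_le_self (by norm_num) ?_)
      linarith [Nat.cast_nonneg (α := ℝ) n]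
    · filter_upwards [hco] with p hp
      rw [hp]
      refine squeeze_zero_norm (fun n => hbound n p) ?_
      simpa [div_eq_mul_inv] using (tendsto_one_div_add_atTop_nhds_zero_nat (𝕜 := ℝ)).const_mul 2

/-- A smooth function vanishing on the Dirichlet part and satisfying Green's formula against all
test functions is an eigenfunction. -/
theorem hasLaplacian_of_green (hP : Bornology.IsBounded P.carrier) {ψ : ℝ × ℝ → ℝ}
    (hψ : ContDiff ℝ ∞ ψ) (h0 : ∀ p ∈ P.dirichlet, ψ p = 0) (l : ℝ)
    (hgreen : ∀ φ : ℝ × ℝ → ℝ, ContDiff ℝ ∞ φ → Disjoint (tsupport φ) P.dirichlet →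
      ∫ p in P.carrier, (fderiv ℝ ψ p (1, 0) * fderiv ℝ φ p (1, 0) +
        fderiv ℝ ψ p (0, 1) * fderiv ℝ φ p (0, 1)) = l * ∫ p in P.carrier, ψ p * φ p) :
    P.HasLaplacian (toL2 hP ψ hψ.continuous) (-l • toL2 hP ψ hψ.continuous) := by
  refine (hasLaplacian_iff hP _ _).2 ⟨(toL2 hP _ (continuous_fderiv_apply hψ (1, 0)),
    toL2 hP _ (continuous_fderiv_apply hψ (0, 1))),
    (hasGrad_iff_mem_closure hP _ _ _).1 (hasGrad_of_contDiff hP hψ h0), ?_⟩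
  -- Green's formula against a fixed function is a closed condition on the test graph, so smooth
  -- test functions suffice.
  have hcl : closure (P.testGraph : Set (P.L2 × P.L2 × P.L2)) ⊆
      {z | inner ℝ (toL2 hP _ (continuous_fderiv_apply hψ (1, 0))) z.2.1 +
        inner ℝ (toL2 hP _ (continuous_fderiv_apply hψ (0, 1))) z.2.2 =
        -inner ℝ (-l • toL2 hP ψ hψ.continuous) z.1} := by
    refine closure_minimal ?_ (isClosed_eq (by fun_prop) (by fun_prop))
    rintro ⟨v, hx, hy⟩ ⟨φ, ⟨hφ, hd⟩, ha, hb, hc⟩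
    simp only at ha hb hc
    simp only [Set.mem_ofPred_eq, inner_smul_left, conj_trivial, neg_mul, neg_neg]
    have hg := hgreen φ hφ hd
    have e1 : ∫ p, (toL2 hP ψ hψ.continuous p * v p) ∂P.measure = ∫ p in P.carrier, ψ p * φ p := by
      refine integral_congr_ae ?_
      filter_upwards [coeFn_toL2 hP hψ.continuous, ha] with p h1 h2
      rw [h1, h2]
    have e2 : ∫ p, (toL2 hP _ (continuous_fderiv_apply hψ (1, 0)) p * hx p +
        toL2 hP _ (continuous_fderiv_apply hψ (0, 1)) p * hy p) ∂P.measure =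
        ∫ p in P.carrier, (fderiv ℝ ψ p (1, 0) * fderiv ℝ φ p (1, 0) +
        fderiv ℝ ψ p (0, 1) * fderiv ℝ φ p (0, 1)) := by
      refine integral_congr_ae ?_
      filter_upwards [coeFn_toL2 hP (continuous_fderiv_apply hψ (1, 0)), hb,
        coeFn_toL2 hP (continuous_fderiv_apply hψ (0, 1)), hc] with p h1 h2 h3 h4
      rw [h1, h2, h3, h4]
    have e3 := (green_iff (toL2 hP _ (continuous_fderiv_apply hψ (1, 0)))
      (toL2 hP _ (continuous_fderiv_apply hψ (0, 1))) hx hy (-l • toL2 hP ψ hψ.continuous) v).1 (by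
        rw [e2, hg, ← e1, ← L2.real_inner_eq_integral_mul, ← L2.real_inner_eq_integral_mul,
          inner_smul_left]
        simp)
    rw [e3, inner_smul_left]
    simp
  exact fun z hz => hcl hz

end MixedDomain

/-! ### Fubini and the divergence theorem on rectangles and triangles -/

/-- Fubini's theorem for a region between two graphs over the first axis. -/
theorem setIntegral_region_fst {S : Set (ℝ × ℝ)} (hm : MeasurableSet S) {a : ℝ} (ha : 0 ≤ a)
    {α β : ℝ → ℝ} (hαβ : ∀ x ∈ Set.Ioo 0 a, α x ≤ β x)
    (hS : ∀ x y, (x, y) ∈ S ↔ x ∈ Set.Ioo 0 a ∧ y ∈ Set.Ioo (α x) (β x)) {G : ℝ × ℝ → ℝ}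
    (hG : IntegrableOn G S) :
    ∫ p in S, G p = ∫ x in (0 : ℝ)..a, ∫ y in α x..β x, G (x, y) := by
  rw [← integral_indicator hm, Measure.volume_eq_prod, integral_prod _
    ((integrable_indicator_iff hm).2 hG), intervalIntegral.integral_of_le ha,
    integral_Ioc_eq_integral_Ioo, ← integral_indicator measurableSet_Ioo]
  refine integral_congr_ae (Eventually.of_forall fun x => ?_)
  by_cases hx : x ∈ Set.Ioo 0 a
  · simp only [Set.indicator_of_mem hx]
    rw [intervalIntegral.integral_of_le (hαβ x hx), integral_Ioc_eq_integral_Ioo,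
      ← integral_indicator measurableSet_Ioo]
    refine integral_congr_ae (Eventually.of_forall fun y => ?_)
    by_cases hy : y ∈ Set.Ioo (α x) (β x)
    · simp only [Set.indicator_of_mem hy, Set.indicator_of_mem ((hS x y).2 ⟨hx, hy⟩)]
    · simp only [Set.indicator_of_notMem hy,
        Set.indicator_of_notMem (fun h => hy ((hS x y).1 h).2)]
  · simp only [Set.indicator_of_notMem hx]
    have : ∀ y, S.indicator G (x, y) = 0 := fun y =>
      Set.indicator_of_notMem (fun h => hx ((hS x y).1 h).1) _
    simp [this]

/-- Fubini's theorem for a region between two graphs over the second axis. -/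
theorem setIntegral_region_snd {S : Set (ℝ × ℝ)} (hm : MeasurableSet S) {b : ℝ} (hb : 0 ≤ b)
    {α β : ℝ → ℝ} (hαβ : ∀ y ∈ Set.Ioo 0 b, α y ≤ β y)
    (hS : ∀ x y, (x, y) ∈ S ↔ y ∈ Set.Ioo 0 b ∧ x ∈ Set.Ioo (α y) (β y)) {G : ℝ × ℝ → ℝ}
    (hG : IntegrableOn G S) :
    ∫ p in S, G p = ∫ y in (0 : ℝ)..b, ∫ x in α y..β y, G (x, y) := by
  have hmp : MeasurePreserving (Prod.swap : ℝ × ℝ → ℝ × ℝ) volume volume :=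
    Measure.measurePreserving_swap
  have hemb : MeasurableEmbedding (Prod.swap : ℝ × ℝ → ℝ × ℝ) :=
    MeasurableEquiv.prodComm.measurableEmbedding
  rw [← hmp.setIntegral_preimage_emb hemb]
  exact setIntegral_region_fst (hm.preimage measurable_swap) hb hαβ (fun x y => hS y x)
    ((hmp.integrableOn_comp_preimage hemb).2 hG)

namespace MixedDomain

theorem measurableSet_rectangle (a b : ℝ) : MeasurableSet (rectangle a b) :=
  ((measurableSet_lt measurable_const measurable_fst).inter
    ((measurableSet_lt measurable_fst measurable_const).inter
      ((measurableSet_lt measurable_const measurable_snd).inter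
        (measurableSet_lt measurable_snd measurable_const))))

theorem measurableSet_triangle (c : ℝ) : MeasurableSet (triangle c) :=
  ((measurableSet_lt measurable_const measurable_snd).inter
    ((measurableSet_lt measurable_snd measurable_fst).inter
      (measurableSet_lt measurable_fst measurable_const)))

theorem isBounded_rectangle (a b : ℝ) : Bornology.IsBounded (rectangle a b) :=
  ((Metric.isBounded_Icc (0 : ℝ) a).prod (Metric.isBounded_Icc (0 : ℝ) b)).subset
    fun _ hp => ⟨⟨hp.1.le, hp.2.1.le⟩, ⟨hp.2.2.1.le, hp.2.2.2.le⟩⟩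

theorem triangle_subset_rectangle (c : ℝ) : triangle c ⊆ rectangle c c :=
  fun _ hp => ⟨hp.1.trans hp.2.1, hp.2.2, hp.1, hp.2.1.trans hp.2.2⟩

theorem isBounded_triangle (c : ℝ) : Bornology.IsBounded (triangle c) :=
  (isBounded_rectangle c c).subset (triangle_subset_rectangle c)

theorem integrableOn_rectangle {G : ℝ × ℝ → ℝ} (hG : Continuous G) (a b : ℝ) :
    IntegrableOn G (rectangle a b) :=
  memLp_one_iff_integrable.1
    (memLp_of_continuous (P := ⟨rectangle a b, ∅⟩) (isBounded_rectangle a b) hG 1)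

theorem integrableOn_triangle {G : ℝ × ℝ → ℝ} (hG : Continuous G) (c : ℝ) :
    IntegrableOn G (triangle c) :=
  (integrableOn_rectangle hG c c).mono_set (triangle_subset_rectangle c)

theorem integral_rectangle_fst {a b : ℝ} (ha : 0 ≤ a) (hb : 0 ≤ b) {G : ℝ × ℝ → ℝ}
    (hG : Continuous G) :
    ∫ p in rectangle a b, G p = ∫ x in (0 : ℝ)..a, ∫ y in (0 : ℝ)..b, G (x, y) :=
  setIntegral_region_fst (α := fun _ => 0) (β := fun _ => b) (measurableSet_rectangle a b) ha
    (fun _ _ => hb) (fun x y => by simp [rectangle, and_assoc]) (integrableOn_rectangle hG a b)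

theorem integral_rectangle_snd {a b : ℝ} (ha : 0 ≤ a) (hb : 0 ≤ b) {G : ℝ × ℝ → ℝ}
    (hG : Continuous G) :
    ∫ p in rectangle a b, G p = ∫ y in (0 : ℝ)..b, ∫ x in (0 : ℝ)..a, G (x, y) :=
  setIntegral_region_snd (α := fun _ => 0) (β := fun _ => a) (measurableSet_rectangle a b) hb
    (fun _ _ => ha) (fun x y => by simp only [rectangle, Set.mem_ofPred_eq, Set.mem_Ioo]; tauto)
    (integrableOn_rectangle hG a b)

theorem integral_triangle_fst {c : ℝ} (hc : 0 ≤ c) {G : ℝ × ℝ → ℝ} (hG : Continuous G) :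
    ∫ p in triangle c, G p = ∫ x in (0 : ℝ)..c, ∫ y in (0 : ℝ)..x, G (x, y) :=
  setIntegral_region_fst (α := fun _ => 0) (β := fun x => x) (measurableSet_triangle c) hc
    (fun _ hx => hx.1.le) (fun x y => by
      simp only [triangle, Set.mem_ofPred_eq, Set.mem_Ioo]
      constructor
      · rintro ⟨h1, h2, h3⟩
        exact ⟨⟨h1.trans h2, h3⟩, h1, h2⟩
      · rintro ⟨⟨h1, h2⟩, h3, h4⟩
        exact ⟨h3, h4, h2⟩) (integrableOn_triangle hG c)

theorem integral_triangle_snd {c : ℝ} (hc : 0 ≤ c) {G : ℝ × ℝ → ℝ} (hG : Continuous G) :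
    ∫ p in triangle c, G p = ∫ y in (0 : ℝ)..c, ∫ x in y..c, G (x, y) :=
  setIntegral_region_snd (α := fun y => y) (β := fun _ => c) (measurableSet_triangle c) hc
    (fun _ hx => hx.2.le) (fun x y => by
      simp only [triangle, Set.mem_ofPred_eq, Set.mem_Ioo]
      constructor
      · rintro ⟨h1, h2, h3⟩
        exact ⟨⟨h1, h2.trans h3⟩, h2, h3⟩
      · rintro ⟨⟨h1, h2⟩, h3, h4⟩
        exact ⟨h1, h3, h4⟩) (integrableOn_triangle hG c)

section Divergence

variable {F G F' G' : ℝ × ℝ → ℝ}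

theorem integral_divergence_rectangle {a b : ℝ} (ha : 0 ≤ a) (hb : 0 ≤ b)
    (hcF' : Continuous F') (hcG' : Continuous G')
    (hF : ∀ x y, HasDerivAt (fun x => F (x, y)) (F' (x, y)) x)
    (hG : ∀ x y, HasDerivAt (fun y => G (x, y)) (G' (x, y)) y) :
    ∫ p in rectangle a b, (F' p + G' p) =
      (∫ y in (0 : ℝ)..b, (F (a, y) - F (0, y))) + ∫ x in (0 : ℝ)..a, (G (x, b) - G (x, 0)) := by
  rw [integral_add (integrableOn_rectangle hcF' a b) (integrableOn_rectangle hcG' a b),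
    integral_rectangle_snd ha hb hcF', integral_rectangle_fst ha hb hcG']
  congr 1
  · refine intervalIntegral.integral_congr fun y _ => ?_
    exact intervalIntegral.integral_eq_sub_of_hasDerivAt (fun x _ => hF x y)
      ((hcF'.comp (by fun_prop)).intervalIntegrable _ _)
  · refine intervalIntegral.integral_congr fun x _ => ?_
    exact intervalIntegral.integral_eq_sub_of_hasDerivAt (fun y _ => hG x y)
      ((hcG'.comp (by fun_prop)).intervalIntegrable _ _)

/-- Each derivative is integrated along its own axis: horizontal slices run from the hypotenuse to
the leg x = c, vertical ones from the leg y = 0 to the hypotenuse. The hypotenuse contributes the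
combination F - G, its normal flux in the parameter s. -/
theorem integral_divergence_triangle {c : ℝ} (hc : 0 ≤ c)
    (hcF : Continuous F) (hcG : Continuous G) (hcF' : Continuous F') (hcG' : Continuous G')
    (hF : ∀ x y, HasDerivAt (fun x => F (x, y)) (F' (x, y)) x)
    (hG : ∀ x y, HasDerivAt (fun y => G (x, y)) (G' (x, y)) y) :
    ∫ p in triangle c, (F' p + G' p) =
      ∫ s in (0 : ℝ)..c, (F (c, s) - (F (s, s) - G (s, s)) - G (s, 0)) := by
  have h1 : ∫ p in triangle c, F' p = ∫ s in (0 : ℝ)..c, (F (c, s) - F (s, s)) := by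
    rw [integral_triangle_snd hc hcF']
    refine intervalIntegral.integral_congr fun y _ => ?_
    exact intervalIntegral.integral_eq_sub_of_hasDerivAt (fun x _ => hF x y)
      ((hcF'.comp (by fun_prop)).intervalIntegrable _ _)
  have h2 : ∫ p in triangle c, G' p = ∫ s in (0 : ℝ)..c, (G (s, s) - G (s, 0)) := by
    rw [integral_triangle_fst hc hcG']
    refine intervalIntegral.integral_congr fun x _ => ?_
    exact intervalIntegral.integral_eq_sub_of_hasDerivAt (fun y _ => hG x y)
      ((hcG'.comp (by fun_prop)).intervalIntegrable _ _)
  rw [integral_add (integrableOn_triangle hcF' c) (integrableOn_triangle hcG' c), h1, h2,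
    ← intervalIntegral.integral_add]
  · refine intervalIntegral.integral_congr fun s _ => ?_
    ring
  · exact ((hcF.comp (by fun_prop)).sub (hcF.comp (by fun_prop))).intervalIntegrable _ _
  · exact ((hcG.comp (by fun_prop)).sub (hcG.comp (by fun_prop))).intervalIntegrable _ _

end Divergence

/-! ### Sine modes as eigenfunctions -/

/-- The superposition `sin αx sin βy + ε sin βx sin αy` of two plane standing waves. -/
noncomputable def mode (α β ε : ℝ) (p : ℝ × ℝ) : ℝ :=
  Real.sin (α * p.1) * Real.sin (β * p.2) + ε * (Real.sin (β * p.1) * Real.sin (α * p.2))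

/-- The partial derivative of `mode` in the first variable. -/
noncomputable def modeX (α β ε : ℝ) (p : ℝ × ℝ) : ℝ :=
  α * (Real.cos (α * p.1) * Real.sin (β * p.2)) +
    ε * (β * (Real.cos (β * p.1) * Real.sin (α * p.2)))

/-- The partial derivative of `mode` in the second variable. -/
noncomputable def modeY (α β ε : ℝ) (p : ℝ × ℝ) : ℝ :=
  β * (Real.sin (α * p.1) * Real.cos (β * p.2)) +
    ε * (α * (Real.sin (β * p.1) * Real.cos (α * p.2)))

variable (α β ε : ℝ)

theorem contDiff_mode : ContDiff ℝ ∞ (mode α β ε) := by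
  unfold mode
  fun_prop

theorem continuous_modeX : Continuous (modeX α β ε) := by
  unfold modeX
  fun_prop

theorem continuous_modeY : Continuous (modeY α β ε) := by
  unfold modeY
  fun_prop

theorem hasDerivAt_sin_mul (a x : ℝ) :
    HasDerivAt (fun x => Real.sin (a * x)) (a * Real.cos (a * x)) x := by
  have h := ((hasDerivAt_id x).const_mul a).sin
  simpa [mul_comm] using h

theorem hasDerivAt_cos_mul (a x : ℝ) :
    HasDerivAt (fun x => Real.cos (a * x)) (-(a * Real.sin (a * x))) x := by
  have h := ((hasDerivAt_id x).const_mul a).cos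
  simpa [mul_comm] using h

theorem hasDerivAt_mode_fst (x y : ℝ) :
    HasDerivAt (fun x => mode α β ε (x, y)) (modeX α β ε (x, y)) x := by
  have h := ((hasDerivAt_sin_mul α x).mul_const (Real.sin (β * y))).fun_add
    (((hasDerivAt_sin_mul β x).mul_const (Real.sin (α * y))).const_mul ε)
  refine h.congr_deriv ?_
  simp only [modeX]
  ring

theorem hasDerivAt_mode_snd (x y : ℝ) :
    HasDerivAt (fun y => mode α β ε (x, y)) (modeY α β ε (x, y)) y := by
  have h := ((hasDerivAt_sin_mul β y).const_mul (Real.sin (α * x))).fun_add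
    (((hasDerivAt_sin_mul α y).const_mul (Real.sin (β * x))).const_mul ε)
  refine h.congr_deriv ?_
  simp only [modeY]
  ring

theorem hasDerivAt_modeX_fst (x y : ℝ) :
    HasDerivAt (fun x => modeX α β ε (x, y)) (-(α ^ 2 * (Real.sin (α * x) * Real.sin (β * y)) +
      ε * (β ^ 2 * (Real.sin (β * x) * Real.sin (α * y))))) x := by
  have h := (((hasDerivAt_cos_mul α x).mul_const (Real.sin (β * y))).const_mul α).fun_add
    ((((hasDerivAt_cos_mul β x).mul_const (Real.sin (α * y))).const_mul β).const_mul ε)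
  refine h.congr_deriv ?_
  ring

theorem hasDerivAt_modeY_snd (x y : ℝ) :
    HasDerivAt (fun y => modeY α β ε (x, y)) (-(β ^ 2 * (Real.sin (α * x) * Real.sin (β * y)) +
      ε * (α ^ 2 * (Real.sin (β * x) * Real.sin (α * y))))) y := by
  have h := (((hasDerivAt_cos_mul β y).const_mul (Real.sin (α * x))).const_mul β).fun_add
    ((((hasDerivAt_cos_mul α y).const_mul (Real.sin (β * x))).const_mul α).const_mul ε)
  refine h.congr_deriv ?_
  ring

theorem fderiv_mode_fst (p : ℝ × ℝ) : fderiv ℝ (mode α β ε) p (1, 0) = modeX α β ε p :=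
  (hasDerivAt_fst_of_differentiable ((contDiff_mode α β ε).differentiable (by simp))
    p.1 p.2).unique (hasDerivAt_mode_fst α β ε p.1 p.2)

theorem fderiv_mode_snd (p : ℝ × ℝ) : fderiv ℝ (mode α β ε) p (0, 1) = modeY α β ε p :=
  (hasDerivAt_snd_of_differentiable ((contDiff_mode α β ε).differentiable (by simp))
    p.1 p.2).unique (hasDerivAt_mode_snd α β ε p.1 p.2)

variable {α β ε} {P : MixedDomain}

/-- The class of a mode in `L²`. -/
noncomputable def modeL2 (hP : Bornology.IsBounded P.carrier) (α β ε : ℝ) : P.L2 :=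
  toL2 hP (mode α β ε) (contDiff_mode α β ε).continuous

/-- Reduction of the eigenvalue equation of a mode to the vanishing of the boundary terms. -/
theorem hasLaplacian_mode (hP : Bornology.IsBounded P.carrier)
    (h0 : ∀ p ∈ P.dirichlet, mode α β ε p = 0)
    (hbdry : ∀ φ : ℝ × ℝ → ℝ, Continuous φ → (∀ p ∈ P.dirichlet, φ p = 0) →
      ∀ F' G' : ℝ × ℝ → ℝ, Continuous F' → Continuous G' →
      (∀ x y, HasDerivAt (fun x => modeX α β ε (x, y) * φ (x, y)) (F' (x, y)) x) →
      (∀ x y, HasDerivAt (fun y => modeY α β ε (x, y) * φ (x, y)) (G' (x, y)) y) →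
      ∫ p in P.carrier, (F' p + G' p) = 0) :
    P.HasLaplacian (modeL2 hP α β ε) (-(α ^ 2 + β ^ 2) • modeL2 hP α β ε) := by
  refine hasLaplacian_of_green hP (contDiff_mode α β ε) h0 _ fun φ hφ hd => ?_
  simp only [fderiv_mode_fst, fderiv_mode_snd]
  have hcm := (contDiff_mode α β ε).continuous
  have hcX := continuous_modeX α β ε
  have hcY := continuous_modeY α β ε
  have hc1 := continuous_fderiv_apply hφ (1, 0)
  have hc2 := continuous_fderiv_apply hφ (0, 1)
  have hc := hφ.continuous
  have hdiff := hφ.differentiable (by simp)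
  have hφ0 : ∀ p ∈ P.dirichlet, φ p = 0 := fun p hp =>
    image_eq_zero_of_notMem_tsupport fun h => Set.disjoint_left.1 hd h hp
  -- The field is φ∇ψ for the mode ψ; its divergence is ∇ψ·∇φ - (α² + β²) ψ φ, so a vanishing
  -- boundary flux is Green's formula.
  have key := hbdry φ hc hφ0
    (fun p => -(α ^ 2 * (Real.sin (α * p.1) * Real.sin (β * p.2)) +
      ε * (β ^ 2 * (Real.sin (β * p.1) * Real.sin (α * p.2)))) * φ p +
      modeX α β ε p * fderiv ℝ φ p (1, 0))
    (fun p => -(β ^ 2 * (Real.sin (α * p.1) * Real.sin (β * p.2)) +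
      ε * (α ^ 2 * (Real.sin (β * p.1) * Real.sin (α * p.2)))) * φ p +
      modeY α β ε p * fderiv ℝ φ p (0, 1)) (by fun_prop) (by fun_prop)
    (fun x y => (hasDerivAt_modeX_fst α β ε x y).fun_mul
      (hasDerivAt_fst_of_differentiable hdiff x y))
    (fun x y => (hasDerivAt_modeY_snd α β ε x y).fun_mul
      (hasDerivAt_snd_of_differentiable hdiff x y))
  have hi : ∀ G : ℝ × ℝ → ℝ, Continuous G → Integrable G P.measure := fun G hG =>
    memLp_one_iff_integrable.1 (memLp_of_continuous hP hG 1)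
  rw [← integral_const_mul, ← sub_eq_zero, ← integral_sub (hi _ (by fun_prop)) (hi _ (by fun_prop))]
  refine Eq.trans ?_ key
  refine integral_congr_ae (Eventually.of_forall fun p => ?_)
  simp only [mode]
  ring

/-- On each edge the flux of φ∇ψ dies because φ vanishes there (Dirichlet) or because the normal
derivative of ψ does (Neumann); on the hypotenuse the latter means that the two partial derivatives
agree. -/
theorem hasLaplacian_mode_triangle (hP : Bornology.IsBounded P.carrier) {c : ℝ} (hc : 0 ≤ c)
    (hcar : P.carrier = triangle c) (h0 : ∀ p ∈ P.dirichlet, mode α β ε p = 0)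
    (hbot : ∀ s ∈ Set.Icc 0 c, (s, (0 : ℝ)) ∈ P.dirichlet)
    (hright : ∀ s ∈ Set.Icc 0 c, (c, s) ∈ P.dirichlet ∨ modeX α β ε (c, s) = 0)
    (hdiag : ∀ s ∈ Set.Icc 0 c, (s, s) ∈ P.dirichlet ∨ modeX α β ε (s, s) = modeY α β ε (s, s)) :
    P.HasLaplacian (modeL2 hP α β ε) (-(α ^ 2 + β ^ 2) • modeL2 hP α β ε) := by
  refine hasLaplacian_mode hP h0 fun φ hφ hφ0 F' G' hF' hG' hF hG => ?_
  rw [hcar, integral_divergence_triangle hc ((continuous_modeX α β ε).mul hφ)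
    ((continuous_modeY α β ε).mul hφ) hF' hG' hF hG]
  refine (intervalIntegral.integral_congr fun s hs => ?_).trans intervalIntegral.integral_zero
  rw [Set.uIcc_of_le hc] at hs
  have e1 : modeX α β ε (c, s) * φ (c, s) = 0 := by
    rcases hright s hs with h | h
    · rw [hφ0 _ h, mul_zero]
    · rw [h, zero_mul]
  have e2 : modeX α β ε (s, s) * φ (s, s) - modeY α β ε (s, s) * φ (s, s) = 0 := by
    rcases hdiag s hs with h | h
    · rw [hφ0 _ h, mul_zero, mul_zero, sub_zero]
    · rw [h, sub_self]
  have e3 : modeY α β ε (s, 0) * φ (s, 0) = 0 := by rw [hφ0 _ (hbot s hs), mul_zero]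
  simp [e1, e2, e3]

theorem hasLaplacian_mode_rectangle (hP : Bornology.IsBounded P.carrier) {a b : ℝ} (ha : 0 ≤ a)
    (hb : 0 ≤ b) (hcar : P.carrier = rectangle a b) (h0 : ∀ p ∈ P.dirichlet, mode α β ε p = 0)
    (hbot : ∀ s ∈ Set.Icc 0 a, (s, (0 : ℝ)) ∈ P.dirichlet)
    (htop : ∀ s ∈ Set.Icc 0 a, (s, b) ∈ P.dirichlet)
    (hleft : ∀ s ∈ Set.Icc 0 b, ((0 : ℝ), s) ∈ P.dirichlet)
    (hright : ∀ s ∈ Set.Icc 0 b, (a, s) ∈ P.dirichlet ∨ modeX α β ε (a, s) = 0) :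
    P.HasLaplacian (modeL2 hP α β ε) (-(α ^ 2 + β ^ 2) • modeL2 hP α β ε) := by
  refine hasLaplacian_mode hP h0 fun φ hφ hφ0 F' G' hF' hG' hF hG => ?_
  rw [hcar, integral_divergence_rectangle (F := fun p => modeX α β ε p * φ p)
    (G := fun p => modeY α β ε p * φ p) ha hb hF' hG' hF hG]
  have i1 : ∫ s in (0 : ℝ)..b, (modeX α β ε (a, s) * φ (a, s) - modeX α β ε (0, s) * φ (0, s))
      = 0 := by
    refine (intervalIntegral.integral_congr fun s hs => ?_).trans intervalIntegral.integral_zero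
    rw [Set.uIcc_of_le hb] at hs
    have e1 : modeX α β ε (a, s) * φ (a, s) = 0 := by
      rcases hright s hs with h | h
      · rw [hφ0 _ h, mul_zero]
      · rw [h, zero_mul]
    simp [e1, hφ0 _ (hleft s hs)]
  have i2 : ∫ s in (0 : ℝ)..a, (modeY α β ε (s, b) * φ (s, b) - modeY α β ε (s, 0) * φ (s, 0))
      = 0 := by
    refine (intervalIntegral.integral_congr fun s hs => ?_).trans intervalIntegral.integral_zero
    rw [Set.uIcc_of_le ha] at hs
    simp [hφ0 _ (hbot s hs), hφ0 _ (htop s hs)]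
  exact (congrArg₂ (· + ·) i1 i2).trans (add_zero 0)

end MixedDomain

/-! ### Completeness of products of sine waves -/

section StoneWeierstrass

variable {X : Type*} [TopologicalSpace X] [CompactSpace X] [MeasurableSpace X] [BorelSpace X]
  {μ : Measure X}

theorem integrable_mul_continuousMap {h : X → ℝ} (hh : Integrable h μ) (g : C(X, ℝ)) :
    Integrable (fun x => h x * g x) μ := by
  refine hh.mul_bdd (c := ‖g‖) g.continuous.measurable.aestronglyMeasurable ?_
  exact Eventually.of_forall fun x => g.norm_coe_le_norm x

theorem continuous_integral_mul_continuousMap {h : X → ℝ} (hh : Integrable h μ) :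
    Continuous fun g : C(X, ℝ) => ∫ x, h x * g x ∂μ := by
  refine continuous_iff_continuousAt.2 fun g => ?_
  have hev : ∀ᶠ g' : C(X, ℝ) in 𝓝 g, ‖g'‖ < ‖g‖ + 1 :=
    (continuous_norm.tendsto g).eventually_lt_const (by linarith)
  refine continuousAt_of_dominated (bound := fun x => |h x| * (‖g‖ + 1)) ?_ ?_ ?_ ?_
  · exact Eventually.of_forall fun g' => (integrable_mul_continuousMap hh g').aestronglyMeasurable
  · filter_upwards [hev] with g' hg'
    refine Eventually.of_forall fun x => ?_
    rw [norm_mul]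
    exact mul_le_mul_of_nonneg_left ((g'.norm_coe_le_norm x).trans hg'.le) (norm_nonneg _)
  · exact hh.abs.mul_const _
  · refine Eventually.of_forall fun x => ?_
    exact (continuous_const.mul (ContinuousEvalConst.continuous_eval_const x)).continuousAt

/-- An integrable function orthogonal to a point-separating subalgebra of continuous functions on a
compact space is orthogonal to all continuous functions. -/
theorem integral_mul_eq_zero_of_separatesPoints {h : X → ℝ} (hh : Integrable h μ)
    (A : Subalgebra ℝ C(X, ℝ)) (hA : A.SeparatesPoints)
    (h0 : ∀ g ∈ A, ∫ x, h x * g x ∂μ = 0) (g : C(X, ℝ)) : ∫ x, h x * g x ∂μ = 0 := by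
  have hcl : closure (A : Set C(X, ℝ)) ⊆ {g | ∫ x, h x * g x ∂μ = 0} :=
    closure_minimal h0 (isClosed_eq (continuous_integral_mul_continuousMap hh) continuous_const)
  have htop := ContinuousMap.subalgebra_topologicalClosure_eq_top_of_separatesPoints A hA
  refine hcl ?_
  rw [← Subalgebra.topologicalClosure_coe, htop]
  trivial

end StoneWeierstrass

/-- The frequency of the `k`-th sine wave on an interval of length `L`: `σ = 1` for the Dirichlet
condition and `σ = 1 / 2` for the Neumann condition at the right end. -/
noncomputable def freq (L σ k : ℝ) : ℝ := (k + σ) * Real.pi / L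

/-- The waves of negative index are, up to sign, waves of nonnegative index. -/
theorem exists_sin_freq_eq_nat {L σ : ℝ} (hσ : σ = 1 ∨ σ = 1 / 2) (k : ℤ) :
    ∃ (j : ℕ) (s : ℝ), ∀ x, Real.sin (freq L σ k * x) = s * Real.sin (freq L σ j * x) := by
  rcases le_or_gt 0 k with hk | hk
  · lift k to ℕ using hk
    exact ⟨k, 1, fun x => by simp⟩
  · have hneg : ∀ j : ℕ, (j : ℤ) + k + 2 * σ = 0 → ∃ (j : ℕ) (s : ℝ), ∀ x,
        Real.sin (freq L σ k * x) = s * Real.sin (freq L σ j * x) := by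
      intro j hj
      push_cast at hj
      refine ⟨j, -1, fun x => ?_⟩
      rw [neg_one_mul, ← Real.sin_neg]
      congr 1
      simp only [freq]
      rw [show (k : ℝ) + σ = -(j + σ) by linarith]
      ring
    -- Negating the frequency sends k to -k - 2 for σ = 1, with fixed index -1 where the wave is
    -- zero, and to -k - 1 for σ = 1 / 2, with no fixed integer.
    rcases hσ with rfl | rfl
    · rcases eq_or_lt_of_le (show k ≤ -1 by omega) with rfl | h
      · exact ⟨0, 0, fun x => by simp [freq]⟩
      · obtain ⟨j, hj⟩ := Int.eq_ofNat_of_zero_le (show 0 ≤ -k - 2 by omega)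
        refine hneg j ?_
        rw [← hj]
        push_cast
        ring
    · obtain ⟨j, hj⟩ := Int.eq_ofNat_of_zero_le (show 0 ≤ -k - 1 by omega)
      refine hneg j ?_
      rw [← hj]
      push_cast
      ring

/-- The cosine of the fundamental frequency shifts the index by one in both directions and preserves
σ. Integer indices are used because index 0 is lowered to -1. -/
theorem cos_mul_sin_freq (L σ : ℝ) (k : ℤ) (x : ℝ) :
    Real.cos (Real.pi / L * x) * Real.sin (freq L σ k * x) =
      (1 / 2) * Real.sin (freq L σ (k + 1 : ℤ) * x) + (1 / 2) * Real.sin (freq L σ (k - 1 : ℤ) * x) := by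
  have h1 : freq L σ (k + 1 : ℤ) * x = freq L σ k * x + Real.pi / L * x := by
    simp only [freq]
    push_cast
    ring
  have h2 : freq L σ (k - 1 : ℤ) * x = freq L σ k * x - Real.pi / L * x := by
    simp only [freq]
    push_cast
    ring
  rw [h1, h2, Real.sin_add, Real.sin_sub]
  ring

theorem sin_freq_zero_pos {L σ : ℝ} (hL : 0 < L) (hσ : σ = 1 ∨ σ = 1 / 2) {x : ℝ} (hx : 0 < x)
    (hxL : x < L) : 0 < Real.sin (freq L σ (0 : ℤ) * x) := by
  have h1 : 0 < σ := by rcases hσ with rfl | rfl <;> norm_num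
  have h2 : σ ≤ 1 := by rcases hσ with rfl | rfl <;> norm_num
  have e : freq L σ (0 : ℤ) * x = σ * (x / L) * Real.pi := by
    simp only [freq]
    push_cast
    ring
  have h3 : x / L < 1 := (div_lt_one hL).2 hxL
  have h4 : 0 < x / L := div_pos hx hL
  rw [e]
  refine Real.sin_pos_of_pos_of_lt_pi (by positivity) ?_
  have : σ * (x / L) < 1 := by nlinarith
  nlinarith [Real.pi_pos]

/-- This supplies point separation on the closed interval, endpoints included, where Dirichlet sines
would fail. -/
theorem injOn_cos_mul {L : ℝ} (hL : 0 < L) :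
    Set.InjOn (fun x => Real.cos (Real.pi / L * x)) (Set.Icc 0 L) := by
  intro x hx y hy h
  have hm : ∀ z ∈ Set.Icc 0 L, Real.pi / L * z ∈ Set.Icc 0 Real.pi := fun z hz => by
    refine ⟨mul_nonneg (div_nonneg Real.pi_pos.le hL.le) hz.1, ?_⟩
    rw [div_mul_eq_mul_div, div_le_iff₀ hL]
    exact mul_le_mul_of_nonneg_left hz.2 Real.pi_pos.le
  have h' := Real.injOn_cos (hm x hx) (hm y hy) h
  exact mul_left_cancel₀ (div_pos Real.pi_pos hL).ne' h'

namespace MixedDomain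

theorem isOpen_rectangle (a b : ℝ) : IsOpen (rectangle a b) :=
  ((isOpen_lt continuous_const continuous_fst).inter
    ((isOpen_lt continuous_fst continuous_const).inter
      ((isOpen_lt continuous_const continuous_snd).inter
        (isOpen_lt continuous_snd continuous_const))))

/-- Completeness of the products of sine waves on a rectangle. -/
theorem ae_eq_zero_of_integral_sin_mul_sin {a b σ τ : ℝ} (ha : 0 < a) (hb : 0 < b)
    (hσ : σ = 1 ∨ σ = 1 / 2) (hτ : τ = 1 ∨ τ = 1 / 2) {f : ℝ × ℝ → ℝ}
    (hf : IntegrableOn f (rectangle a b))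
    (h0 : ∀ m n : ℕ, ∫ p in rectangle a b,
      f p * (Real.sin (freq a σ m * p.1) * Real.sin (freq b τ n * p.2)) = 0) :
    ∀ᵐ p, p ∈ rectangle a b → f p = 0 := by
  have hRm := measurableSet_rectangle a b
  -- Stone–Weierstrass needs a compact space, so f is extended by zero to the closed rectangle.
  set K : Set (ℝ × ℝ) := Set.Icc 0 a ×ˢ Set.Icc 0 b with hK
  have hKc : IsCompact K := isCompact_Icc.prod isCompact_Icc
  have hRK : rectangle a b ⊆ K := fun p hp =>
    ⟨⟨hp.1.le, hp.2.1.le⟩, ⟨hp.2.2.1.le, hp.2.2.2.le⟩⟩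
  have := isCompact_iff_compactSpace.1 hKc
  set μ : Measure K := Measure.comap Subtype.val volume with hμ
  have htrans : ∀ g : ℝ × ℝ → ℝ, ∫ x : K, (rectangle a b).indicator f x * g x ∂μ =
      ∫ p in rectangle a b, f p * g p := by
    intro g
    rw [hμ, integral_subtype_comap hKc.measurableSet
      (fun p => (rectangle a b).indicator f p * g p)]
    have : (fun p => (rectangle a b).indicator f p * g p) =
        (rectangle a b).indicator fun p => f p * g p := by
      funext p
      by_cases hp : p ∈ rectangle a b <;> simp [hp]
    rw [this, setIntegral_indicator hRm, Set.inter_eq_right.2 hRK]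
  have hFint : Integrable (fun x : K => (rectangle a b).indicator f x) μ :=
    (integrableOn_iff_comap_subtypeVal hKc.measurableSet).1
      ((integrable_indicator_iff hRm).2 hf).integrableOn
  set s : ℤ → C(K, ℝ) := fun k => ⟨fun x => Real.sin (freq a σ k * x.1.1), by fun_prop⟩ with hs
  set t : ℤ → C(K, ℝ) := fun k => ⟨fun x => Real.sin (freq b τ k * x.1.2), by fun_prop⟩ with ht
  set c : C(K, ℝ) := ⟨fun x => Real.cos (Real.pi / a * x.1.1), by fun_prop⟩ with hc
  set d : C(K, ℝ) := ⟨fun x => Real.cos (Real.pi / b * x.1.2), by fun_prop⟩ with hd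
  let I : C(K, ℝ) → ℝ := fun g => ∫ x : K, (rectangle a b).indicator f x * g x ∂μ
  have hI : ∀ g, I g = ∫ x : K, (rectangle a b).indicator f x * g x ∂μ := fun g => rfl
  have hIadd : ∀ g g', I (g + g') = I g + I g' := fun g g' => by
    rw [hI, hI, hI, ← integral_add (integrable_mul_continuousMap hFint g)
      (integrable_mul_continuousMap hFint g')]
    refine integral_congr_ae (Eventually.of_forall fun x => ?_)
    simp [mul_add]
  have hIsmul : ∀ (r : ℝ) g, I (r • g) = r * I g := fun r g => by
    rw [hI, hI, ← integral_const_mul]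
    refine integral_congr_ae (Eventually.of_forall fun x => ?_)
    simp [mul_left_comm]
  have hbase : ∀ m n, I (s m * t n) = 0 := by
    intro m n
    obtain ⟨j, r, hj⟩ := exists_sin_freq_eq_nat (L := a) hσ m
    obtain ⟨k, q, hk⟩ := exists_sin_freq_eq_nat (L := b) hτ n
    have : s m * t n = (r * q) • (s j * t k) := by
      ext x
      simp only [hs, ht, ContinuousMap.mul_apply, ContinuousMap.coe_mk, ContinuousMap.smul_apply,
        smul_eq_mul, hj, hk, Int.cast_natCast]
      ring
    rw [this, hIsmul, hI]
    have := htrans fun p => Real.sin (freq a σ j * p.1) * Real.sin (freq b τ k * p.2)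
    rw [h0] at this
    simp only [hs, ht, ContinuousMap.mul_apply, ContinuousMap.coe_mk, Int.cast_natCast]
    rw [this, mul_zero]
  have hcs : ∀ m, c * s m = (1 / 2 : ℝ) • s (m + 1) + (1 / 2 : ℝ) • s (m - 1) := fun m => by
    ext x
    exact cos_mul_sin_freq a σ m x.1.1
  have hdt : ∀ n, d * t n = (1 / 2 : ℝ) • t (n + 1) + (1 / 2 : ℝ) • t (n - 1) := fun n => by
    ext x
    exact cos_mul_sin_freq b τ n x.1.2
  -- Orthogonality to all s m * t n survives multiplication by a polynomial in the two cosines. The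
  -- extra factor g makes the product case of the induction go through.
  have hstep : ∀ P ∈ Algebra.adjoin ℝ {c, d}, ∀ g : C(K, ℝ), (∀ m n, I (s m * t n * g) = 0) →
      ∀ m n, I (s m * t n * (P * g)) = 0 := by
    intro P hP
    induction hP using Algebra.adjoin_induction with
    | mem P hP =>
      intro g hg m n
      rcases hP with rfl | rfl
      · rw [show s m * t n * (c * g) = c * s m * (t n * g) by ring, hcs, add_mul, smul_mul_assoc,
          smul_mul_assoc, ← mul_assoc, ← mul_assoc, hIadd, hIsmul, hIsmul, hg, hg]
        simp
      · rw [show s m * t n * (d * g) = d * t n * (s m * g) by ring, hdt, add_mul, smul_mul_assoc,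
          smul_mul_assoc, ← mul_assoc, ← mul_assoc, mul_comm (t _), mul_comm (t _), hIadd, hIsmul,
          hIsmul, hg, hg]
        simp
    | algebraMap r =>
      intro g hg m n
      rw [Algebra.algebraMap_eq_smul_one, smul_mul_assoc, one_mul, mul_smul_comm, hIsmul, hg,
        mul_zero]
    | add P Q _ _ hP hQ =>
      intro g hg m n
      rw [add_mul, mul_add, hIadd, hP g hg, hQ g hg, add_zero]
    | mul P Q _ _ hP hQ =>
      intro g hg m n
      rw [mul_assoc P Q g]
      exact hP _ (hQ g hg) m n
  have hsep : (Algebra.adjoin ℝ {c, d}).SeparatesPoints := by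
    intro x y hxy
    by_contra hcon
    push Not at hcon
    have h1 := hcon c ⟨c, Algebra.subset_adjoin (by simp), rfl⟩
    have h2 := hcon d ⟨d, Algebra.subset_adjoin (by simp), rfl⟩
    exact hxy (Subtype.ext (Prod.ext (injOn_cos_mul ha x.2.1 y.2.1 h1)
      (injOn_cos_mul hb x.2.2 y.2.2 h2)))
  -- The function f * s 0 * t 0 is orthogonal to the cosine algebra, hence to every continuous
  -- function, hence zero almost everywhere; the lowest waves are positive inside, so they can be
  -- divided out.
  have hall := integral_mul_eq_zero_of_separatesPoints
    (integrable_mul_continuousMap hFint (s 0 * t 0)) _ hsep (fun P hP => by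
      have := hstep P hP 1 (fun m n => by rw [mul_one]; exact hbase m n) 0 0
      rw [hI] at this
      simpa [mul_assoc] using this)
  have hprod : ∀ᵐ p, p ∈ rectangle a b →
      f p * (Real.sin (freq a σ (0 : ℤ) * p.1) * Real.sin (freq b τ (0 : ℤ) * p.2)) = 0 := by
    refine (isOpen_rectangle a b).ae_eq_zero_of_integral_contDiff_smul_eq_zero ?_ ?_
    · refine IntegrableOn.locallyIntegrableOn ?_
      have := (memLp_of_continuous (P := ⟨rectangle a b, ∅⟩) (isBounded_rectangle a b)
        (φ := fun p => Real.sin (freq a σ (0 : ℤ) * p.1) * Real.sin (freq b τ (0 : ℤ) * p.2))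
        (by fun_prop) ∞)
      exact Integrable.mul_of_top_left hf this
    · intro g hg _ hgU
      have e := hall ⟨fun x => g x, by have := hg.continuous; fun_prop⟩
      have e2 := htrans fun p => (Real.sin (freq a σ (0 : ℤ) * p.1) *
        Real.sin (freq b τ (0 : ℤ) * p.2)) * g p
      have e3 : ∫ p in rectangle a b, f p * ((Real.sin (freq a σ (0 : ℤ) * p.1) *
        Real.sin (freq b τ (0 : ℤ) * p.2)) * g p) = 0 := by
        rw [← e2, ← e]
        refine integral_congr_ae (Eventually.of_forall fun x => ?_)
        simp only [hs, ht, ContinuousMap.mul_apply, ContinuousMap.coe_mk]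
        ring
      rw [← e3, ← setIntegral_eq_integral_of_forall_compl_eq_zero (s := rectangle a b)]
      · refine integral_congr_ae (Eventually.of_forall fun x => ?_)
        simp only [smul_eq_mul]
        ring
      · intro p hp
        rw [image_eq_zero_of_notMem_tsupport fun h => hp (hgU h), zero_smul]
  filter_upwards [hprod] with p hp hpR
  have h1 := sin_freq_zero_pos ha hσ hpR.1 hpR.2.1
  have h2 := sin_freq_zero_pos hb hτ hpR.2.2.1 hpR.2.2.2
  exact (mul_eq_zero.1 (hp hpR)).resolve_right (mul_pos h1 h2).ne'

end MixedDomain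

/-! ### Orthogonality, and the passage from squares to triangles -/

theorem integral_cos_int_mul_pi_div {L : ℝ} (hL : 0 < L) (n : ℤ) (hn : n ≠ 0) :
    ∫ x in (0 : ℝ)..L, Real.cos (n * Real.pi / L * x) = 0 := by
  have hn' : (n : ℝ) * Real.pi / L ≠ 0 :=
    div_ne_zero (mul_ne_zero (Int.cast_ne_zero.2 hn) Real.pi_ne_zero) hL.ne'
  rw [intervalIntegral.integral_comp_mul_left (fun x => Real.cos x) hn', integral_cos,
    div_mul_cancel₀ _ hL.ne', Real.sin_int_mul_pi]
  simp

/-- Orthogonality of the sine waves on an interval. -/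
theorem integral_sin_freq_mul_sin_freq {L σ : ℝ} (hL : 0 < L) (hσ : σ = 1 ∨ σ = 1 / 2) (j k : ℕ) :
    ∫ x in (0 : ℝ)..L, Real.sin (freq L σ j * x) * Real.sin (freq L σ k * x) =
      if j = k then L / 2 else 0 := by
  -- The sum of the two frequencies is Nπ/L, an integer multiple because 2σ is an integer, and never
  -- zero.
  obtain ⟨N, hN, hN0⟩ : ∃ N : ℤ, (N : ℝ) = j + k + 2 * σ ∧ N ≠ 0 := by
    rcases hσ with rfl | rfl
    · exact ⟨j + k + 2, by push_cast; ring, by omega⟩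
    · exact ⟨j + k + 1, by push_cast; ring, by omega⟩
  have e : ∀ x, Real.sin (freq L σ j * x) * Real.sin (freq L σ k * x) =
      1 / 2 * Real.cos (((j : ℤ) - k : ℤ) * Real.pi / L * x) -
        1 / 2 * Real.cos (N * Real.pi / L * x) := by
    intro x
    have h1 : (((j : ℤ) - k : ℤ) : ℝ) * Real.pi / L * x = freq L σ j * x - freq L σ k * x := by
      simp only [freq]
      push_cast
      ring
    have h2 : (N : ℝ) * Real.pi / L * x = freq L σ j * x + freq L σ k * x := by
      simp only [freq, hN]
      ring
    rw [h1, h2, Real.cos_sub, Real.cos_add]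
    ring
  simp only [e]
  rw [intervalIntegral.integral_sub
    ((by fun_prop : Continuous _).intervalIntegrable _ _)
    ((by fun_prop : Continuous _).intervalIntegrable _ _),
    intervalIntegral.integral_const_mul, intervalIntegral.integral_const_mul,
    integral_cos_int_mul_pi_div hL N hN0]
  split_ifs with h
  · subst h
    simp
    ring
  · rw [integral_cos_int_mul_pi_div hL _ (by omega)]
    simp

namespace MixedDomain

theorem integral_rectangle_mul {a b : ℝ} (ha : 0 ≤ a) (hb : 0 ≤ b) {f g : ℝ → ℝ}
    (hf : Continuous f) (hg : Continuous g) :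
    ∫ p in rectangle a b, f p.1 * g p.2 =
      (∫ x in (0 : ℝ)..a, f x) * ∫ y in (0 : ℝ)..b, g y := by
  rw [integral_rectangle_fst ha hb (G := fun p => f p.1 * g p.2) (by fun_prop),
    ← intervalIntegral.integral_mul_const]
  refine intervalIntegral.integral_congr fun x _ => ?_
  exact intervalIntegral.integral_const_mul (f x) g

/-- The square splits along its diagonal into two triangles. -/
theorem setIntegral_square_eq_triangle {c : ℝ} {G : ℝ × ℝ → ℝ}
    (hG : IntegrableOn G (rectangle c c)) :
    ∫ p in rectangle c c, G p = (∫ p in triangle c, G p) + ∫ p in triangle c, G p.swap := by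
  have hmp : MeasurePreserving (Prod.swap : ℝ × ℝ → ℝ × ℝ) volume volume :=
    Measure.measurePreserving_swap
  have hemb : MeasurableEmbedding (Prod.swap : ℝ × ℝ → ℝ × ℝ) :=
    MeasurableEquiv.prodComm.measurableEmbedding
  have hTm := measurableSet_triangle c
  have hT'm : MeasurableSet (Prod.swap ⁻¹' triangle c) := hTm.preimage measurable_swap
  have hT' : Prod.swap ⁻¹' triangle c ⊆ rectangle c c := fun p hp =>
    ⟨hp.1, hp.2.1.trans hp.2.2, hp.1.trans hp.2.1, hp.2.2⟩
  have hdiag : ∀ᵐ p : ℝ × ℝ, p.1 ≠ p.2 := by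
    have hm : MeasurableSet {p : ℝ × ℝ | p.1 ≠ p.2} :=
      (measurableSet_eq_fun measurable_fst measurable_snd).compl
    rw [Measure.volume_eq_prod, Measure.ae_prod_iff_ae_ae hm]
    refine Eventually.of_forall fun x => ?_
    filter_upwards [compl_mem_ae_iff.2 (measure_singleton (μ := (volume : Measure ℝ)) x)] with y hy
    exact fun h => hy h.symm
  have hset : rectangle c c =ᵐ[volume] (triangle c ∪ Prod.swap ⁻¹' triangle c : Set (ℝ × ℝ)) := by
    refine eventuallyEq_set.2 ?_
    filter_upwards [hdiag] with p hp
    constructor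
    · rintro ⟨h1, h2, h3, h4⟩
      rcases lt_or_gt_of_ne hp with h | h
      · exact Or.inr ⟨h1, h, h4⟩
      · exact Or.inl ⟨h3, h, h2⟩
    · rintro (h | h)
      · exact triangle_subset_rectangle c h
      · exact hT' h
  have hdisj : Disjoint (triangle c) (Prod.swap ⁻¹' triangle c) :=
    Set.disjoint_left.2 fun p h1 h2 => lt_asymm h1.2.1 h2.2.1
  rw [setIntegral_congr_set hset, setIntegral_union hdisj hT'm
    (hG.mono_set (triangle_subset_rectangle c)) (hG.mono_set hT')]
  congr 1
  exact hmp.setIntegral_preimage_emb hemb (fun p => G p.swap) (triangle c)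

theorem integral_mode_mul_mode_rectangle {a b : ℝ} (ha : 0 ≤ a) (hb : 0 ≤ b) (α β α' β' : ℝ) :
    ∫ p in rectangle a b, mode α β 0 p * mode α' β' 0 p =
      (∫ x in (0 : ℝ)..a, Real.sin (α * x) * Real.sin (α' * x)) *
        ∫ y in (0 : ℝ)..b, Real.sin (β * y) * Real.sin (β' * y) := by
  rw [← integral_rectangle_mul ha hb (by fun_prop) (by fun_prop)]
  refine integral_congr_ae (Eventually.of_forall fun p => ?_)
  simp only [mode]
  ring

theorem mode_swap {ε : ℝ} (hε : ε = 1 ∨ ε = -1) (α β : ℝ) (p : ℝ × ℝ) :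
    mode α β ε p.swap = ε * mode α β ε p := by
  rcases hε with rfl | rfl <;>
  · simp only [mode, Prod.fst_swap, Prod.snd_swap]
    ring

theorem mode_comm {ε : ℝ} (hε : ε = 1 ∨ ε = -1) (α β : ℝ) (p : ℝ × ℝ) :
    mode β α ε p = ε * mode α β ε p := by
  rcases hε with rfl | rfl <;>
  · simp only [mode]
    ring

/-- Under reflection in the diagonal both modes are multiplied by ε, so their product is invariant
and its integral over the triangle is half that over the square. There the four product terms factor
and agree in pairs. -/
theorem integral_mode_mul_mode_triangle {c ε : ℝ} (hc : 0 ≤ c) (hε : ε = 1 ∨ ε = -1)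
    (α β α' β' : ℝ) :
    ∫ p in triangle c, mode α β ε p * mode α' β' ε p =
      (∫ x in (0 : ℝ)..c, Real.sin (α * x) * Real.sin (α' * x)) *
        (∫ y in (0 : ℝ)..c, Real.sin (β * y) * Real.sin (β' * y)) +
      ε * ((∫ x in (0 : ℝ)..c, Real.sin (α * x) * Real.sin (β' * x)) *
        ∫ y in (0 : ℝ)..c, Real.sin (β * y) * Real.sin (α' * y)) := by
  have hcont : Continuous fun p => mode α β ε p * mode α' β' ε p :=
    (contDiff_mode α β ε).continuous.mul (contDiff_mode α' β' ε).continuous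
  have h1 := setIntegral_square_eq_triangle (integrableOn_rectangle hcont c c)
  have hεε : ε * ε = 1 := by rcases hε with rfl | rfl <;> norm_num
  have h2 : ∫ p in triangle c, mode α β ε p.swap * mode α' β' ε p.swap =
      ∫ p in triangle c, mode α β ε p * mode α' β' ε p := by
    refine integral_congr_ae (Eventually.of_forall fun p => ?_)
    simp only [mode_swap hε]
    linear_combination (mode α β ε p * mode α' β' ε p) * hεε
  rw [h2] at h1
  have h3 : ∫ p in rectangle c c, mode α β ε p * mode α' β' ε p =
      ∫ p in rectangle c c,
        ((Real.sin (α * p.1) * Real.sin (α' * p.1)) * (Real.sin (β * p.2) * Real.sin (β' * p.2)) +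
        ε * ((Real.sin (α * p.1) * Real.sin (β' * p.1)) *
          (Real.sin (β * p.2) * Real.sin (α' * p.2))) +
        (ε * ((Real.sin (β * p.1) * Real.sin (α' * p.1)) *
          (Real.sin (α * p.2) * Real.sin (β' * p.2))) +
        (Real.sin (β * p.1) * Real.sin (β' * p.1)) *
          (Real.sin (α * p.2) * Real.sin (α' * p.2)))) := by
    refine integral_congr_ae (Eventually.of_forall fun p => ?_)
    simp only [mode]
    linear_combination (Real.sin (β * p.1) * Real.sin (β' * p.1)) *
          (Real.sin (α * p.2) * Real.sin (α' * p.2)) * hεε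
  rw [integral_add (integrableOn_rectangle (by fun_prop) c c)
    (integrableOn_rectangle (by fun_prop) c c), integral_add
    (integrableOn_rectangle (by fun_prop) c c) (integrableOn_rectangle (by fun_prop) c c),
    integral_add (integrableOn_rectangle (by fun_prop) c c)
    (integrableOn_rectangle (by fun_prop) c c), integral_const_mul, integral_const_mul,
    integral_rectangle_mul hc hc (f := fun x => Real.sin (α * x) * Real.sin (α' * x))
      (g := fun x => Real.sin (β * x) * Real.sin (β' * x)) (by fun_prop) (by fun_prop),
    integral_rectangle_mul hc hc (f := fun x => Real.sin (α * x) * Real.sin (β' * x))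
      (g := fun x => Real.sin (β * x) * Real.sin (α' * x)) (by fun_prop) (by fun_prop),
    integral_rectangle_mul hc hc (f := fun x => Real.sin (β * x) * Real.sin (α' * x))
      (g := fun x => Real.sin (α * x) * Real.sin (β' * x)) (by fun_prop) (by fun_prop),
    integral_rectangle_mul hc hc (f := fun x => Real.sin (β * x) * Real.sin (β' * x))
      (g := fun x => Real.sin (α * x) * Real.sin (α' * x)) (by fun_prop) (by fun_prop)] at h3
  linarith

/-- Completeness of the symmetrized, or antisymmetrized, products of sine waves on a triangle. -/
theorem ae_eq_zero_of_integral_mode_triangle {c σ ε : ℝ} (hc : 0 < c) (hσ : σ = 1 ∨ σ = 1 / 2)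
    {f : ℝ × ℝ → ℝ} (hf : IntegrableOn f (triangle c))
    (h0 : ∀ m n : ℕ, ∫ p in triangle c, f p * mode (freq c σ m) (freq c σ n) ε p = 0) :
    ∀ᵐ p, p ∈ triangle c → f p = 0 := by
  have hmp : MeasurePreserving (Prod.swap : ℝ × ℝ → ℝ × ℝ) volume volume :=
    Measure.measurePreserving_swap
  have hTm := measurableSet_triangle c
  set g : ℝ × ℝ → ℝ := (triangle c).indicator f with hg
  have hgi : Integrable g := (integrable_indicator_iff hTm).2 hf
  have hgs : Integrable fun p : ℝ × ℝ => g p.swap := hmp.integrable_comp_of_integrable hgi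
  -- F is the extension of f to the square with parity ε under reflection; integrating it against a
  -- product of sines folds back to f against the mode.
  set F : ℝ × ℝ → ℝ := fun p => g p + ε * g p.swap with hF
  have hFi : Integrable F := hgi.add (hgs.const_mul ε)
  have hF1 : ∀ p ∈ triangle c, F p = f p := fun p hp => by
    have : p.swap ∉ triangle c := fun h => lt_asymm hp.2.1 h.2.1
    simp [hF, hg, hp, this]
  have hF2 : ∀ p ∈ triangle c, F p.swap = ε * f p := fun p hp => by
    have : p.swap ∉ triangle c := fun h => lt_asymm hp.2.1 h.2.1
    simp [hF, hg, hp, this]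
  have key := ae_eq_zero_of_integral_sin_mul_sin hc hc hσ hσ hFi.integrableOn fun m n => by
    have hbd : MemLp (fun p : ℝ × ℝ => Real.sin (freq c σ m * p.1) * Real.sin (freq c σ n * p.2)) ∞
        (volume.restrict (triangle c)) :=
      memLp_of_continuous (P := ⟨triangle c, ∅⟩) (isBounded_triangle c) (by fun_prop) ∞
    have hbd' : MemLp (fun p : ℝ × ℝ => Real.sin (freq c σ m * p.2) * Real.sin (freq c σ n * p.1))
        ∞ (volume.restrict (triangle c)) :=
      memLp_of_continuous (P := ⟨triangle c, ∅⟩) (isBounded_triangle c) (by fun_prop) ∞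
    have hbd'' : MemLp (fun p : ℝ × ℝ => Real.sin (freq c σ m * p.1) * Real.sin (freq c σ n * p.2))
        ∞ (volume.restrict (rectangle c c)) :=
      memLp_of_continuous (P := ⟨rectangle c c, ∅⟩) (isBounded_rectangle c c) (by fun_prop) ∞
    refine (setIntegral_square_eq_triangle (G := fun p => F p *
      (Real.sin (freq c σ m * p.1) * Real.sin (freq c σ n * p.2)))
      (hFi.integrableOn.mul_of_top_left hbd'')).trans ?_
    rw [← h0 m n]
    have e1 : ∫ p in triangle c,
        F p * (Real.sin (freq c σ m * p.1) * Real.sin (freq c σ n * p.2)) =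
        ∫ p in triangle c, f p * (Real.sin (freq c σ m * p.1) * Real.sin (freq c σ n * p.2)) :=
      setIntegral_congr_fun hTm fun p hp => by simp only [hF1 p hp]
    have e2 : ∫ p in triangle c, F p.swap *
        (Real.sin (freq c σ m * p.swap.1) * Real.sin (freq c σ n * p.swap.2)) =
        ∫ p in triangle c,
          ε * (f p * (Real.sin (freq c σ m * p.2) * Real.sin (freq c σ n * p.1))) :=
      setIntegral_congr_fun hTm fun p hp => by
        simp only [hF2 p hp, Prod.fst_swap, Prod.snd_swap]
        ring
    rw [e1, e2]
    refine (integral_add (hf.mul_of_top_left hbd)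
      ((hf.mul_of_top_left hbd').const_mul ε)).symm.trans ?_
    refine integral_congr_ae (Eventually.of_forall fun p => ?_)
    simp only [mode, Pi.mul_apply]
    ring
  filter_upwards [key] with p hp hpT
  rw [← hF1 p hpT]
  exact hp (triangle_subset_rectangle c hpT)

/-! ### Heat flow and heat content from a total family of modes -/

variable {P : MixedDomain}

/-- The heat flow on a domain whose Laplacian is diagonalized by a total orthogonal family
of modes. -/
theorem exists_isHeatFlow_of_modes {ι : Type*} (hP : Bornology.IsBounded P.carrier)
    (hm : MeasurableSet P.carrier) (α β : ι → ℝ) (ε : ℝ)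
    (hlap : ∀ i, P.HasLaplacian (modeL2 hP (α i) (β i) ε)
      (-(α i ^ 2 + β i ^ 2) • modeL2 hP (α i) (β i) ε))
    (horth : ∀ i j, i ≠ j → ∫ p in P.carrier, mode (α i) (β i) ε p * mode (α j) (β j) ε p = 0)
    (hpos : ∀ i, 0 < ∫ p in P.carrier, mode (α i) (β i) ε p * mode (α i) (β i) ε p)
    (htot : ∀ f : ℝ × ℝ → ℝ, IntegrableOn f P.carrier →
      (∀ i, ∫ p in P.carrier, f p * mode (α i) (β i) ε p = 0) → ∀ᵐ p, p ∈ P.carrier → f p = 0)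
    (hsum : ∀ s : ℝ, 0 < s → Summable fun i => Real.exp (-((α i ^ 2 + β i ^ 2) * s))) :
    ∃ (u : ℝ → P.L2) (V : ℝ), P.IsHeatFlow u ∧
      HasSum (fun i => (∫ p in P.carrier, mode (α i) (β i) ε p) ^ 2 /
        ∫ p in P.carrier, mode (α i) (β i) ε p * mode (α i) (β i) ε p) V ∧
      ∀ t, 0 < t → HasSum (fun i => Real.exp (-((α i ^ 2 + β i ^ 2) * t)) *
        ((∫ p in P.carrier, mode (α i) (β i) ε p) ^ 2 /
          ∫ p in P.carrier, mode (α i) (β i) ε p * mode (α i) (β i) ε p))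
        (∫ p, u t p ∂P.measure) := by
  have := isFiniteMeasure_of_isBounded hP
  have hc : ∀ i, Continuous (mode (α i) (β i) ε) := fun i => (contDiff_mode _ _ _).continuous
  have hin : ∀ i j, inner ℝ (modeL2 hP (α i) (β i) ε) (modeL2 hP (α j) (β j) ε) =
      ∫ p in P.carrier, mode (α i) (β i) ε p * mode (α j) (β j) ε p := fun i j => by
    rw [L2.real_inner_eq_integral_mul]
    refine integral_congr_ae ?_
    filter_upwards [coeFn_toL2 hP (hc i), coeFn_toL2 hP (hc j)] with p h1 h2
    simp only [modeL2, h1, h2]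
  have hnorm : ∀ i, ‖modeL2 hP (α i) (β i) ε‖ ^ 2 =
      ∫ p in P.carrier, mode (α i) (β i) ε p * mode (α i) (β i) ε p := fun i => by
    rw [← real_inner_self_eq_norm_sq, hin]
  -- Pairing with the datum 1 is integration over the domain, so the expansion of the inner product
  -- of g with u t is that of the heat content.
  set g : P.L2 := toL2 hP (fun _ => 1) continuous_const with hg
  have hg1 : g =ᵐ[P.measure] fun _ => 1 := coeFn_toL2 hP continuous_const
  have hig : ∀ w : P.L2, inner ℝ g w = ∫ p, w p ∂P.measure := fun w => by
    rw [L2.real_inner_eq_integral_mul]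
    refine integral_congr_ae ?_
    filter_upwards [hg1] with p h1
    rw [h1, one_mul]
  have hmg : ∀ i, inner ℝ (modeL2 hP (α i) (β i) ε) g = ∫ p in P.carrier, mode (α i) (β i) ε p :=
    fun i => by
      rw [real_inner_comm, hig]
      exact integral_congr_ae (coeFn_toL2 hP (hc i))
  obtain ⟨u, h0, hlim, hd, hs, hV⟩ := exists_flow_of_orthogonal (laplacianGraph hP)
    (isClosed_laplacianGraph hP) (v := fun i => modeL2 hP (α i) (β i) ε)
    (fun i j hij => (hin i j).trans (horth i j hij)) (fun i h => by
      have := hpos i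
      rw [← hnorm, show modeL2 hP (α i) (β i) ε = 0 from h] at this
      simp at this) (fun x hx => by
      have h := htot x (memLp_one_iff_integrable.1 ((Lp.memLp x).mono_exponent (by norm_num)))
        fun i => by
          have e := hx i
          rw [real_inner_comm, L2.real_inner_eq_integral_mul] at e
          rw [← e]
          refine integral_congr_ae ?_
          filter_upwards [coeFn_toL2 hP (hc i)] with p h1
          simp only [modeL2, h1]
      refine Lp.ext ?_
      filter_upwards [(ae_restrict_iff' hm).2 h, Lp.coeFn_zero ℝ 2 P.measure] with p h1 h2
      rw [h1, h2]
      rfl) (fun i => α i ^ 2 + β i ^ 2) (fun i => by positivity) hsum hlap g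
  simp only [hmg, hnorm, hig] at hs hV
  refine ⟨u, _, ⟨?_, hlim, hd⟩, hV, hs⟩
  rw [h0]
  exact hg1

/-- The leading terms of an exponential sum with nonnegative coefficients. -/
theorem _root_.abs_sub_sum_le_of_hasSum_exp {ι : Type*} {l c : ι → ℝ} {t q V Λ : ℝ} (ht : 0 ≤ t)
    (hc : ∀ i, 0 ≤ c i) (hV : HasSum c V)
    (hq : HasSum (fun i => Real.exp (-(l i * t)) * c i) q) (s : Finset ι)
    (hs : ∀ i, i ∉ s → Λ ≤ l i) :
    |q - ∑ i ∈ s, Real.exp (-(l i * t)) * c i| ≤ V * Real.exp (-(Λ * t)) := by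
  classical
  have h1 : HasSum (fun i => if i ∈ s then Real.exp (-(l i * t)) * c i else 0)
      (∑ i ∈ s, Real.exp (-(l i * t)) * c i) := by
    have h : HasSum (fun i => if i ∈ s then Real.exp (-(l i * t)) * c i else 0)
        (∑ i ∈ s, if i ∈ s then Real.exp (-(l i * t)) * c i else 0) :=
      hasSum_sum_of_ne_finset_zero fun i hi => if_neg hi
    rwa [Finset.sum_congr rfl fun i hi => if_pos hi] at h
  have h2 := hq.sub h1
  have hterm : ∀ i, 0 ≤ Real.exp (-(l i * t)) * c i -
      (if i ∈ s then Real.exp (-(l i * t)) * c i else 0) ∧ Real.exp (-(l i * t)) * c i -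
      (if i ∈ s then Real.exp (-(l i * t)) * c i else 0) ≤ c i * Real.exp (-(Λ * t)) := by
    intro i
    have := Real.exp_pos (-(l i * t))
    have := Real.exp_pos (-(Λ * t))
    split_ifs with hi
    · rw [sub_self]
      exact ⟨le_rfl, mul_nonneg (hc i) (by positivity)⟩
    · rw [sub_zero]
      refine ⟨mul_nonneg (by positivity) (hc i), ?_⟩
      rw [mul_comm]
      refine mul_le_mul_of_nonneg_left (Real.exp_le_exp.2 ?_) (hc i)
      have := mul_le_mul_of_nonneg_right (hs i hi) ht
      linarith
  rw [abs_of_nonneg (h2.nonneg fun i => (hterm i).1)]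
  exact hasSum_le (fun i => (hterm i).2) h2 (hV.mul_right _)

/-- Since (n + σ)² ≥ n, the terms are dominated by a product of two geometric series. -/
theorem _root_.summable_exp_neg_freq {a b σ τ s : ℝ} (ha : 0 < a) (hb : 0 < b)
    (hσ : σ = 1 ∨ σ = 1 / 2) (hτ : τ = 1 ∨ τ = 1 / 2) (hs : 0 < s) :
    Summable fun i : ℕ × ℕ => Real.exp (-((freq a σ i.1 ^ 2 + freq b τ i.2 ^ 2) * s)) := by
  have h1 : ∀ {L ρ : ℝ}, 0 < L → (ρ = 1 ∨ ρ = 1 / 2) → ∀ n : ℕ,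
      n * (Real.pi / L) ^ 2 ≤ freq L ρ n ^ 2 := by
    intro L ρ _ hρ n
    have e : freq L ρ n ^ 2 = (n + ρ) ^ 2 * (Real.pi / L) ^ 2 := by
      simp only [freq]
      ring
    rw [e]
    refine mul_le_mul_of_nonneg_right ?_ (sq_nonneg _)
    have hn : (0 : ℝ) ≤ n := n.cast_nonneg
    rcases hρ with rfl | rfl <;> nlinarith
  have h2 : ∀ {L : ℝ}, 0 < L → Summable fun n : ℕ => Real.exp (-((Real.pi / L) ^ 2 * s)) ^ n := by
    intro L hL
    refine summable_geometric_of_lt_one (Real.exp_pos _).le (Real.exp_lt_one_iff.2 ?_)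
    have : 0 < (Real.pi / L) ^ 2 * s := by
      have := Real.pi_pos
      positivity
    linarith
  refine Summable.of_nonneg_of_le (fun _ => (Real.exp_pos _).le) (fun i => ?_)
    ((h2 ha).mul_of_nonneg (h2 hb) (fun n => by positivity) (fun n => by positivity))
  rw [← Real.exp_nat_mul, ← Real.exp_nat_mul, ← Real.exp_add]
  refine Real.exp_le_exp.2 ?_
  have e1 := mul_le_mul_of_nonneg_right (h1 ha hσ i.1) hs.le
  have e2 := mul_le_mul_of_nonneg_right (h1 hb hτ i.2) hs.le
  linarith

end MixedDomain

namespace MixedDomain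

/-- The weight of a mode in the heat content. -/
noncomputable def modeWeight (P : MixedDomain) (α β ε : ℝ) : ℝ :=
  (∫ p in P.carrier, mode α β ε p) ^ 2 / ∫ p in P.carrier, mode α β ε p * mode α β ε p

theorem modeWeight_nonneg (P : MixedDomain) (α β ε : ℝ) : 0 ≤ modeWeight P α β ε :=
  div_nonneg (sq_nonneg _) (integral_nonneg fun _ => mul_self_nonneg _)

variable {P : MixedDomain}

/-- The heat flow on a rectangle and the expansion of its heat content. -/
theorem exists_isHeatFlow_rectangle (hP : Bornology.IsBounded P.carrier) {a b σ τ : ℝ}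
    (ha : 0 < a) (hb : 0 < b) (hcar : P.carrier = rectangle a b)
    (hσ : σ = 1 ∨ σ = 1 / 2) (hτ : τ = 1 ∨ τ = 1 / 2)
    (hlap : ∀ m n : ℕ, P.HasLaplacian (modeL2 hP (freq a σ m) (freq b τ n) 0)
      (-(freq a σ m ^ 2 + freq b τ n ^ 2) • modeL2 hP (freq a σ m) (freq b τ n) 0))
    (s : Finset (ℕ × ℕ)) (Λ : ℝ)
    (hs : ∀ i, i ∉ s → Λ ≤ freq a σ i.1 ^ 2 + freq b τ i.2 ^ 2) :
    ∃ (u : ℝ → P.L2) (V : ℝ), P.IsHeatFlow u ∧ ∀ t, 0 < t →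
      |∫ p, u t p ∂P.measure - ∑ i ∈ s, Real.exp (-((freq a σ i.1 ^ 2 + freq b τ i.2 ^ 2) * t)) *
        modeWeight P (freq a σ i.1) (freq b τ i.2) 0| ≤ V * Real.exp (-(Λ * t)) := by
  have hin : ∀ i j : ℕ × ℕ, ∫ p in P.carrier, mode (freq a σ i.1) (freq b τ i.2) 0 p *
      mode (freq a σ j.1) (freq b τ j.2) 0 p =
        (if i.1 = j.1 then a / 2 else 0) * if i.2 = j.2 then b / 2 else 0 := fun i j => by
    rw [hcar, integral_mode_mul_mode_rectangle ha.le hb.le, integral_sin_freq_mul_sin_freq ha hσ,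
      integral_sin_freq_mul_sin_freq hb hτ]
  obtain ⟨u, V, hu, hV, hq⟩ := exists_isHeatFlow_of_modes hP
    (by rw [hcar]; exact measurableSet_rectangle a b) (fun i : ℕ × ℕ => freq a σ i.1)
    (fun i => freq b τ i.2) 0 (fun i => hlap i.1 i.2)
    (fun i j hij => by
      rw [hin]
      by_cases h : i.1 = j.1
      · rw [if_neg (fun h' => hij (Prod.ext h h')), mul_zero]
      · rw [if_neg h, zero_mul])
    (fun i => by
      rw [hin, if_pos rfl, if_pos rfl]
      positivity)
    (fun f hf h0 => by
      rw [hcar] at hf ⊢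
      refine ae_eq_zero_of_integral_sin_mul_sin ha hb hσ hτ hf fun m n => ?_
      have h := h0 (m, n)
      rw [hcar] at h
      simpa only [mode, zero_mul, add_zero] using h)
    (fun s hs => summable_exp_neg_freq ha hb hσ hτ hs)
  exact ⟨u, V, hu, fun t ht => abs_sub_sum_le_of_hasSum_exp ht.le
    (fun i => modeWeight_nonneg P _ _ _) hV (hq t ht) s hs⟩

/-- The pairs of indices labelling the modes on a triangle. -/
abbrev TriangleIndex (ε : ℝ) : Type := {i : ℕ × ℕ // i.1 < i.2 ∨ (i.1 = i.2 ∧ ε = 1)}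

theorem integral_mode_freq_mul_mode_freq {c σ ε : ℝ} (hc : 0 < c) (hσ : σ = 1 ∨ σ = 1 / 2)
    (hε : ε = 1 ∨ ε = -1) (i j : ℕ × ℕ) :
    ∫ p in triangle c, mode (freq c σ i.1) (freq c σ i.2) ε p *
      mode (freq c σ j.1) (freq c σ j.2) ε p =
        (if i.1 = j.1 then c / 2 else 0) * (if i.2 = j.2 then c / 2 else 0) +
        ε * ((if i.1 = j.2 then c / 2 else 0) * if i.2 = j.1 then c / 2 else 0) := by
  simp only [integral_mode_mul_mode_triangle hc.le hε, integral_sin_freq_mul_sin_freq hc hσ]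

/-- The heat flow on a triangle and the expansion of its heat content. -/
theorem exists_isHeatFlow_triangle (hP : Bornology.IsBounded P.carrier) {c σ ε : ℝ}
    (hc : 0 < c) (hcar : P.carrier = triangle c)
    (hσ : σ = 1 ∨ σ = 1 / 2) (hε : ε = 1 ∨ ε = -1)
    (hlap : ∀ m n : ℕ, P.HasLaplacian (modeL2 hP (freq c σ m) (freq c σ n) ε)
      (-(freq c σ m ^ 2 + freq c σ n ^ 2) • modeL2 hP (freq c σ m) (freq c σ n) ε))
    (s : Finset (TriangleIndex ε)) (Λ : ℝ)
    (hs : ∀ i, i ∉ s → Λ ≤ freq c σ i.1.1 ^ 2 + freq c σ i.1.2 ^ 2) :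
    ∃ (u : ℝ → P.L2) (V : ℝ), P.IsHeatFlow u ∧ ∀ t, 0 < t →
      |∫ p, u t p ∂P.measure -
        ∑ i ∈ s, Real.exp (-((freq c σ i.1.1 ^ 2 + freq c σ i.1.2 ^ 2) * t)) *
        modeWeight P (freq c σ i.1.1) (freq c σ i.1.2) ε| ≤ V * Real.exp (-(Λ * t)) := by
  obtain ⟨u, V, hu, hV, hq⟩ := exists_isHeatFlow_of_modes hP
    (by rw [hcar]; exact measurableSet_triangle c) (fun i : TriangleIndex ε => freq c σ i.1.1)
    (fun i => freq c σ i.1.2) ε (fun i => hlap i.1.1 i.1.2)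
    (fun i j hij => by
      rw [hcar, integral_mode_freq_mul_mode_freq hc hσ hε]
      have h1 : ¬ (i.1.1 = j.1.1 ∧ i.1.2 = j.1.2) := fun h =>
        hij (Subtype.ext (Prod.ext h.1 h.2))
      have hi : i.1.1 ≤ i.1.2 := i.2.elim le_of_lt fun h => h.1.le
      have hj : j.1.1 ≤ j.1.2 := j.2.elim le_of_lt fun h => h.1.le
      -- Both pairs are ordered, so a crosswise match would force i = j.
      have h2 : ¬ (i.1.1 = j.1.2 ∧ i.1.2 = j.1.1) := fun h => h1 (by omega)
      have h3 : ∀ p q : Prop, ∀ [Decidable p] [Decidable q], ¬ (p ∧ q) →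
          (if p then c / 2 else 0) * (if q then c / 2 else 0) = 0 := by
        intro p q _ _ h
        by_cases hp : p
        · rw [if_neg fun hq => h ⟨hp, hq⟩, mul_zero]
        · rw [if_neg hp, zero_mul]
      rw [h3 _ _ h1, h3 _ _ h2, mul_zero, add_zero])
    (fun i => by
      rw [hcar, integral_mode_freq_mul_mode_freq hc hσ hε, if_pos rfl, if_pos rfl]
      rcases i.2 with h | ⟨h, h'⟩
      · rw [if_neg h.ne, zero_mul, mul_zero, add_zero]
        positivity
      · rw [if_pos h, if_pos h.symm, h']
        positivity)
    (fun f hf h0 => by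
      rw [hcar] at hf ⊢
      refine ae_eq_zero_of_integral_mode_triangle (ε := ε) hc hσ hf fun m n => ?_
      simp only [hcar] at h0
      -- Completeness is stated for all pairs, but modes outside the index set are ε times a
      -- retained mode, or identically zero when m = n and ε = -1.
      rcases lt_trichotomy m n with h | h | h
      · exact h0 ⟨(m, n), Or.inl h⟩
      · rcases hε with hε | hε
        · exact h0 ⟨(m, n), Or.inr ⟨h, hε⟩⟩
        · have : ∀ p, mode (freq c σ m) (freq c σ n) ε p = 0 := fun p => by
            simp only [mode, h, hε]
            ring
          simp [this]
      · have h' := h0 ⟨(n, m), Or.inl h⟩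
        simp only [mode_comm hε (freq c σ n) (freq c σ m), mul_left_comm _ ε]
        rw [integral_const_mul, h', mul_zero])
    (fun s hs => (summable_exp_neg_freq hc hc hσ hσ hs).comp_injective Subtype.val_injective)
  exact ⟨u, V, hu, fun t ht => abs_sub_sum_le_of_hasSum_exp ht.le
    (fun i => modeWeight_nonneg P _ _ _) hV (hq t ht) s hs⟩

/-! ### Boundary conditions of the five kinds of pieces -/

section Segments

theorem mem_segment_horizontal {a h : ℝ} (ha : 0 < a) {p : ℝ × ℝ} :
    p ∈ segment ℝ ((0 : ℝ), h) (a, h) ↔ p.2 = h ∧ p.1 ∈ Set.Icc 0 a := by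
  rw [segment_eq_image']
  constructor
  · rintro ⟨θ, ⟨h0, h1⟩, rfl⟩
    refine ⟨by simp, ?_, ?_⟩
    · simpa using mul_nonneg h0 ha.le
    · simpa using mul_le_of_le_one_left ha.le h1
  · rintro ⟨h2, h0, h1⟩
    refine ⟨p.1 / a, ⟨div_nonneg h0 ha.le, (div_le_one ha).2 h1⟩, Prod.ext ?_ ?_⟩
    · simp [ha.ne']
    · simp [h2]

theorem mem_segment_vertical {w b : ℝ} (hb : 0 < b) {p : ℝ × ℝ} :
    p ∈ segment ℝ (w, (0 : ℝ)) (w, b) ↔ p.1 = w ∧ p.2 ∈ Set.Icc 0 b := by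
  rw [segment_eq_image']
  constructor
  · rintro ⟨θ, ⟨h0, h1⟩, rfl⟩
    refine ⟨by simp, ?_, ?_⟩
    · simpa using mul_nonneg h0 hb.le
    · simpa using mul_le_of_le_one_left hb.le h1
  · rintro ⟨h2, h0, h1⟩
    refine ⟨p.2 / b, ⟨div_nonneg h0 hb.le, (div_le_one hb).2 h1⟩, Prod.ext ?_ ?_⟩
    · simp [h2]
    · simp [hb.ne']

theorem mem_segment_diagonal {c : ℝ} (hc : 0 < c) {p : ℝ × ℝ} :
    p ∈ segment ℝ ((0 : ℝ), (0 : ℝ)) (c, c) ↔ p.1 = p.2 ∧ p.1 ∈ Set.Icc 0 c := by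
  rw [segment_eq_image']
  constructor
  · rintro ⟨θ, ⟨h0, h1⟩, rfl⟩
    refine ⟨by simp, ?_, ?_⟩
    · simpa using mul_nonneg h0 hc.le
    · simpa using mul_le_of_le_one_left hc.le h1
  · rintro ⟨h2, h0, h1⟩
    refine ⟨p.1 / c, ⟨div_nonneg h0 hc.le, (div_le_one hc).2 h1⟩, Prod.ext ?_ ?_⟩
    · simp [hc.ne']
    · simp [hc.ne', h2]

end Segments

section BoundaryValues

variable {L : ℝ}

theorem sin_freq_one_mul (hL : 0 < L) (k : ℕ) : Real.sin (freq L 1 k * L) = 0 := by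
  rw [freq, div_mul_cancel₀ _ hL.ne']
  exact_mod_cast Real.sin_nat_mul_pi (k + 1)

theorem cos_freq_half_mul (hL : 0 < L) (k : ℕ) : Real.cos (freq L (1 / 2) k * L) = 0 := by
  rw [freq, div_mul_cancel₀ _ hL.ne', Real.cos_eq_zero_iff]
  exact ⟨k, by push_cast; ring⟩

theorem mode_bottom (α β ε x : ℝ) : mode α β ε (x, 0) = 0 := by simp [mode]

theorem mode_left (α β ε y : ℝ) : mode α β ε (0, y) = 0 := by simp [mode]

theorem mode_diagonal (α β s : ℝ) : mode α β (-1) (s, s) = 0 := by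
  simp only [mode]
  ring

theorem modeX_diagonal (α β s : ℝ) : modeX α β 1 (s, s) = modeY α β 1 (s, s) := by
  simp only [modeX, modeY]
  ring

end BoundaryValues

/-- The half-integer frequency in x makes the cosine, hence the normal derivative, vanish on the
edge x = a. -/
theorem hasLaplacian_rectangleN {a b : ℝ} (ha : 0 < a) (hb : 0 < b) (m n : ℕ) :
    (rectangleN a b).HasLaplacian
      (modeL2 (P := rectangleN a b) (isBounded_rectangle a b) (freq a (1 / 2) m) (freq b 1 n) 0)
      (-(freq a (1 / 2) m ^ 2 + freq b 1 n ^ 2) • modeL2 (P := rectangleN a b)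
        (isBounded_rectangle a b) (freq a (1 / 2) m) (freq b 1 n) 0) := by
  refine hasLaplacian_mode_rectangle _ ha.le hb.le rfl ?_ ?_ ?_ ?_ ?_
  · rintro ⟨x, y⟩ ((h | h) | h)
    · obtain ⟨rfl, -⟩ := (mem_segment_horizontal ha).1 h
      exact mode_bottom _ _ _ _
    · obtain ⟨rfl, -⟩ := (mem_segment_horizontal ha).1 h
      simp [mode, sin_freq_one_mul hb]
    · obtain ⟨rfl, -⟩ := (mem_segment_vertical hb).1 h
      exact mode_left _ _ _ _
  · exact fun s hs => Or.inl (Or.inl ((mem_segment_horizontal ha).2 ⟨rfl, hs⟩))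
  · exact fun s hs => Or.inl (Or.inr ((mem_segment_horizontal ha).2 ⟨rfl, hs⟩))
  · exact fun s hs => Or.inr ((mem_segment_vertical hb).2 ⟨rfl, hs⟩)
  -- `one_div` is disabled so that σ keeps the shape matched by `cos_freq_half_mul`.
  · exact fun s _ => Or.inr (by simp [modeX, -one_div, cos_freq_half_mul ha])

theorem hasLaplacian_rectangleD {a b : ℝ} (ha : 0 < a) (hb : 0 < b) (m n : ℕ) :
    (rectangleD a b).HasLaplacian
      (modeL2 (P := rectangleD a b) (isBounded_rectangle a b) (freq a 1 m) (freq b 1 n) 0)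
      (-(freq a 1 m ^ 2 + freq b 1 n ^ 2) • modeL2 (P := rectangleD a b)
        (isBounded_rectangle a b) (freq a 1 m) (freq b 1 n) 0) := by
  refine hasLaplacian_mode_rectangle _ ha.le hb.le rfl ?_ ?_ ?_ ?_ ?_
  · rintro ⟨x, y⟩ (((h | h) | h) | h)
    · obtain ⟨rfl, -⟩ := (mem_segment_horizontal ha).1 h
      exact mode_bottom _ _ _ _
    · obtain ⟨rfl, -⟩ := (mem_segment_horizontal ha).1 h
      simp [mode, sin_freq_one_mul hb]
    · obtain ⟨rfl, -⟩ := (mem_segment_vertical hb).1 h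
      exact mode_left _ _ _ _
    · obtain ⟨rfl, -⟩ := (mem_segment_vertical hb).1 h
      simp [mode, sin_freq_one_mul ha]
  · exact fun s hs => Or.inl (Or.inl (Or.inl ((mem_segment_horizontal ha).2 ⟨rfl, hs⟩)))
  · exact fun s hs => Or.inl (Or.inl (Or.inr ((mem_segment_horizontal ha).2 ⟨rfl, hs⟩)))
  · exact fun s hs => Or.inl (Or.inr ((mem_segment_vertical hb).2 ⟨rfl, hs⟩))
  · exact fun s hs => Or.inl (Or.inr ((mem_segment_vertical hb).2 ⟨rfl, hs⟩))

theorem hasLaplacian_triangleD {c : ℝ} (hc : 0 < c) (m n : ℕ) :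
    (triangleD c).HasLaplacian
      (modeL2 (P := triangleD c) (isBounded_triangle c) (freq c 1 m) (freq c 1 n) (-1))
      (-(freq c 1 m ^ 2 + freq c 1 n ^ 2) • modeL2 (P := triangleD c)
        (isBounded_triangle c) (freq c 1 m) (freq c 1 n) (-1)) := by
  refine hasLaplacian_mode_triangle _ hc.le rfl ?_ ?_ ?_ ?_
  · rintro ⟨x, y⟩ ((h | h) | h)
    · obtain ⟨rfl, -⟩ := (mem_segment_horizontal hc).1 h
      exact mode_bottom _ _ _ _
    · obtain ⟨rfl, -⟩ := (mem_segment_vertical hc).1 h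
      simp [mode, sin_freq_one_mul hc]
    · obtain rfl : x = y := ((mem_segment_diagonal hc).1 h).1
      exact mode_diagonal _ _ _
  · exact fun s hs => Or.inl (Or.inl ((mem_segment_horizontal hc).2 ⟨rfl, hs⟩))
  · exact fun s hs => Or.inl (Or.inl (Or.inr ((mem_segment_vertical hc).2 ⟨rfl, hs⟩)))
  · exact fun s hs => Or.inl (Or.inr ((mem_segment_diagonal hc).2 ⟨rfl, hs⟩))

/-- Symmetry (ε = 1) makes the two partial derivatives equal on the diagonal, which is the Neumann
condition there. -/
theorem hasLaplacian_triangleNHyp {c : ℝ} (hc : 0 < c) (m n : ℕ) :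
    (triangleNHyp c).HasLaplacian
      (modeL2 (P := triangleNHyp c) (isBounded_triangle c) (freq c 1 m) (freq c 1 n) 1)
      (-(freq c 1 m ^ 2 + freq c 1 n ^ 2) • modeL2 (P := triangleNHyp c)
        (isBounded_triangle c) (freq c 1 m) (freq c 1 n) 1) := by
  refine hasLaplacian_mode_triangle _ hc.le rfl ?_ ?_ ?_ ?_
  · rintro ⟨x, y⟩ (h | h)
    · obtain ⟨rfl, -⟩ := (mem_segment_horizontal hc).1 h
      exact mode_bottom _ _ _ _
    · obtain ⟨rfl, -⟩ := (mem_segment_vertical hc).1 h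
      simp [mode, sin_freq_one_mul hc]
  · exact fun s hs => Or.inl ((mem_segment_horizontal hc).2 ⟨rfl, hs⟩)
  · exact fun s hs => Or.inl (Or.inr ((mem_segment_vertical hc).2 ⟨rfl, hs⟩))
  · exact fun s _ => Or.inr (modeX_diagonal _ _ _)

/-- Antisymmetry gives the Dirichlet hypotenuse, half-integer frequencies the Neumann leg x = c. -/
theorem hasLaplacian_triangleNLeg {c : ℝ} (hc : 0 < c) (m n : ℕ) :
    (triangleNLeg c).HasLaplacian
      (modeL2 (P := triangleNLeg c) (isBounded_triangle c) (freq c (1 / 2) m) (freq c (1 / 2) n)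
        (-1))
      (-(freq c (1 / 2) m ^ 2 + freq c (1 / 2) n ^ 2) • modeL2 (P := triangleNLeg c)
        (isBounded_triangle c) (freq c (1 / 2) m) (freq c (1 / 2) n) (-1)) := by
  refine hasLaplacian_mode_triangle _ hc.le rfl ?_ ?_ ?_ ?_
  · rintro ⟨x, y⟩ (h | h)
    · obtain ⟨rfl, -⟩ := (mem_segment_horizontal hc).1 h
      exact mode_bottom _ _ _ _
    · obtain rfl : x = y := ((mem_segment_diagonal hc).1 h).1
      exact mode_diagonal _ _ _
  · exact fun s hs => Or.inl ((mem_segment_horizontal hc).2 ⟨rfl, hs⟩)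
  · exact fun s _ => Or.inr (by simp [modeX, -one_div, cos_freq_half_mul hc])
  · exact fun s hs => Or.inl (Or.inr ((mem_segment_diagonal hc).2 ⟨rfl, hs⟩))

end MixedDomain

/-! ### Leading weights of the six pieces -/

namespace MixedDomain

section Integrals

theorem integral_sin_mul {α : ℝ} (hα : α ≠ 0) (c : ℝ) :
    ∫ x in (0 : ℝ)..c, Real.sin (α * x) = (1 - Real.cos (α * c)) / α := by
  rw [intervalIntegral.integral_comp_mul_left (fun x => Real.sin x) hα, integral_sin]
  simp
  ring

theorem integral_sin_mul_cos {α β : ℝ} (h1 : α + β ≠ 0) (h2 : α - β ≠ 0) (c : ℝ) :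
    ∫ x in (0 : ℝ)..c, Real.sin (α * x) * Real.cos (β * x) =
      ((1 - Real.cos (α * c + β * c)) / (α + β) + (1 - Real.cos (α * c - β * c)) / (α - β)) / 2 := by
  have e : ∀ x, Real.sin (α * x) * Real.cos (β * x) =
      1 / 2 * Real.sin ((α + β) * x) + 1 / 2 * Real.sin ((α - β) * x) := fun x => by
    rw [add_mul, sub_mul, Real.sin_add, Real.sin_sub]
    ring
  simp only [e]
  rw [intervalIntegral.integral_add ((by fun_prop : Continuous _).intervalIntegrable _ _)
    ((by fun_prop : Continuous _).intervalIntegrable _ _), intervalIntegral.integral_const_mul,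
    intervalIntegral.integral_const_mul, integral_sin_mul h1, integral_sin_mul h2, add_mul, sub_mul]
  ring

theorem integral_mode_rectangle {a b α β : ℝ} (ha : 0 ≤ a) (hb : 0 ≤ b) (hα : α ≠ 0)
    (hβ : β ≠ 0) : ∫ p in rectangle a b, mode α β 0 p =
      (1 - Real.cos (α * a)) / α * ((1 - Real.cos (β * b)) / β) := by
  rw [← integral_sin_mul hα, ← integral_sin_mul hβ,
    ← integral_rectangle_mul ha hb (by fun_prop) (by fun_prop)]
  simp [mode]

theorem integral_mode_triangle {c α β : ℝ} (hc : 0 ≤ c) (hα : α ≠ 0) (hβ : β ≠ 0)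
    (h1 : α + β ≠ 0) (h2 : α - β ≠ 0) :
    ∫ p in triangle c, mode α β (-1) p =
      ((1 - Real.cos (α * c)) / α - ((1 - Real.cos (α * c + β * c)) / (α + β) +
        (1 - Real.cos (α * c - β * c)) / (α - β)) / 2) / β -
      ((1 - Real.cos (β * c)) / β - ((1 - Real.cos (α * c + β * c)) / (α + β) -
        (1 - Real.cos (α * c - β * c)) / (α - β)) / 2) / α := by
  rw [integral_triangle_fst hc (contDiff_mode α β (-1)).continuous]
  have e : ∀ x, ∫ y in (0 : ℝ)..x, mode α β (-1) (x, y) =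
      (1 / β * Real.sin (α * x) - 1 / β * (Real.sin (α * x) * Real.cos (β * x))) -
      (1 / α * Real.sin (β * x) - 1 / α * (Real.sin (β * x) * Real.cos (α * x))) := fun x => by
    simp only [mode]
    rw [intervalIntegral.integral_add ((by fun_prop : Continuous _).intervalIntegrable _ _)
      ((by fun_prop : Continuous _).intervalIntegrable _ _), intervalIntegral.integral_const_mul,
      intervalIntegral.integral_const_mul, intervalIntegral.integral_const_mul,
      integral_sin_mul hα, integral_sin_mul hβ]
    ring
  have h1' : β + α ≠ 0 := by rwa [add_comm]
  have h2' : β - α ≠ 0 := by rwa [← neg_sub, neg_ne_zero]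
  simp only [e]
  rw [intervalIntegral.integral_sub ((by fun_prop : Continuous _).intervalIntegrable _ _)
    ((by fun_prop : Continuous _).intervalIntegrable _ _), intervalIntegral.integral_sub
    ((by fun_prop : Continuous _).intervalIntegrable _ _)
    ((by fun_prop : Continuous _).intervalIntegrable _ _), intervalIntegral.integral_sub
    ((by fun_prop : Continuous _).intervalIntegrable _ _)
    ((by fun_prop : Continuous _).intervalIntegrable _ _)]
  simp only [intervalIntegral.integral_const_mul]
  rw [integral_sin_mul hα, integral_sin_mul hβ, integral_sin_mul_cos h1 h2,
    integral_sin_mul_cos h1' h2', add_comm (β * c), add_comm β α,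
    show β * c - α * c = -(α * c - β * c) by ring, Real.cos_neg,
    show β - α = -(α - β) by ring, div_neg]
  ring

end Integrals

/-- The heat flow exists, and its heat content is `C exp (-5π²t/4) + O(exp (-2π²t))`. -/
def HasHeatExpansion (P : MixedDomain) (C : ℝ) : Prop :=
  ∃ (u : ℝ → P.L2) (V : ℝ), P.IsHeatFlow u ∧ ∀ t, 0 < t →
    |∫ p, u t p ∂P.measure - C * Real.exp (-(5 * Real.pi ^ 2 * t / 4))| ≤
      V * Real.exp (-(2 * Real.pi ^ 2 * t))

theorem freq_sq (L σ k : ℝ) : freq L σ k ^ 2 = (k + σ) ^ 2 / L ^ 2 * Real.pi ^ 2 := by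
  simp only [freq]
  ring

/-- The mode sin(πx/2) sin(πy) has integral 4/π² and squared norm 1/4; all other eigenvalues exceed
2π². -/
theorem hasHeatExpansion_rectangleN : (rectangleN 1 1).HasHeatExpansion (64 / Real.pi ^ 4) := by
  have hπ := Real.pi_pos
  obtain ⟨u, V, hu, h⟩ := exists_isHeatFlow_rectangle (P := rectangleN 1 1)
    (isBounded_rectangle 1 1) one_pos one_pos rfl (Or.inr rfl) (Or.inl rfl)
    (hasLaplacian_rectangleN one_pos one_pos) {(0, 0)} (2 * Real.pi ^ 2) (by
      rintro ⟨m, n⟩ hmn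
      simp only [freq_sq, ← add_mul]
      refine mul_le_mul_of_nonneg_right ?_ (sq_nonneg _)
      have hm := m.cast_nonneg (α := ℝ)
      have hn := n.cast_nonneg (α := ℝ)
      have : 1 ≤ m ∨ 1 ≤ n := by
        by_contra hcon
        push Not at hcon
        exact hmn (Finset.mem_singleton.2 (Prod.ext (by simp; omega) (by simp; omega)))
      rcases this with h | h
      · have : (1 : ℝ) ≤ m := by exact_mod_cast h
        nlinarith
      · have : (1 : ℝ) ≤ n := by exact_mod_cast h
        nlinarith)
  refine ⟨u, V, hu, fun t ht => ?_⟩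
  have e1 : freq 1 (1 / 2) (0 : ℕ) * 1 = Real.pi / 2 := by
    simp only [freq]
    push_cast
    ring
  have e2 : freq 1 1 (0 : ℕ) * 1 = Real.pi := by
    simp only [freq]
    push_cast
    ring
  have hw : modeWeight (rectangleN 1 1) (freq 1 (1 / 2) (0 : ℕ)) (freq 1 1 (0 : ℕ)) 0 =
      64 / Real.pi ^ 4 := by
    rw [modeWeight, show (rectangleN 1 1).carrier = rectangle 1 1 from rfl,
      integral_mode_mul_mode_rectangle zero_le_one zero_le_one,
      integral_sin_freq_mul_sin_freq one_pos (Or.inr rfl),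
      integral_sin_freq_mul_sin_freq one_pos (Or.inl rfl), integral_mode_rectangle zero_le_one
      zero_le_one (by rw [← mul_one (freq _ _ _), e1]; positivity)
      (by rw [← mul_one (freq _ _ _), e2]; positivity), e1, e2,
      ← mul_one (freq 1 (1 / 2) _), ← mul_one (freq 1 1 _), e1, e2, Real.cos_pi_div_two, Real.cos_pi]
    simp only [if_true]
    field_simp
    norm_num
  have h' := h t ht
  simp only [Finset.sum_singleton] at h'
  rw [hw, freq_sq, freq_sq] at h'
  convert h' using 3
  rw [mul_comm]
  congr 2
  push_cast
  ring

/-- The lowest mode has integral 8/π² and squared norm 1/2. The next eigenvalue, of index (1, 0), is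
exactly 2π², matching the rate of the error term. -/
theorem hasHeatExpansion_rectangleD : (rectangleD 2 1).HasHeatExpansion (128 / Real.pi ^ 4) := by
  have hπ := Real.pi_pos
  obtain ⟨u, V, hu, h⟩ := exists_isHeatFlow_rectangle (P := rectangleD 2 1)
    (isBounded_rectangle 2 1) two_pos one_pos rfl (Or.inl rfl) (Or.inl rfl)
    (hasLaplacian_rectangleD two_pos one_pos) {(0, 0)} (2 * Real.pi ^ 2) (by
      rintro ⟨m, n⟩ hmn
      simp only [freq_sq, ← add_mul]
      refine mul_le_mul_of_nonneg_right ?_ (sq_nonneg _)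
      have hm := m.cast_nonneg (α := ℝ)
      have hn := n.cast_nonneg (α := ℝ)
      have : 1 ≤ m ∨ 1 ≤ n := by
        by_contra hcon
        push Not at hcon
        exact hmn (Finset.mem_singleton.2 (Prod.ext (by simp; omega) (by simp; omega)))
      rcases this with h | h
      · have : (1 : ℝ) ≤ m := by exact_mod_cast h
        nlinarith
      · have : (1 : ℝ) ≤ n := by exact_mod_cast h
        nlinarith)
  refine ⟨u, V, hu, fun t ht => ?_⟩
  have e1 : freq 2 1 (0 : ℕ) = Real.pi / 2 := by
    simp only [freq]
    push_cast
    ring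
  have e2 : freq 1 1 (0 : ℕ) = Real.pi := by
    simp only [freq]
    push_cast
    ring
  have hw : modeWeight (rectangleD 2 1) (freq 2 1 (0 : ℕ)) (freq 1 1 (0 : ℕ)) 0 =
      128 / Real.pi ^ 4 := by
    rw [modeWeight, show (rectangleD 2 1).carrier = rectangle 2 1 from rfl,
      integral_mode_mul_mode_rectangle zero_le_two zero_le_one,
      integral_sin_freq_mul_sin_freq two_pos (Or.inl rfl),
      integral_sin_freq_mul_sin_freq one_pos (Or.inl rfl), e1, e2,
      integral_mode_rectangle zero_le_two zero_le_one (by positivity) (by positivity),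
      div_mul_cancel₀ _ (two_ne_zero' ℝ), mul_one, Real.cos_pi]
    simp only [if_true]
    field_simp
    norm_num
  have h' := h t ht
  simp only [Finset.sum_singleton] at h'
  rw [hw, freq_sq, freq_sq] at h'
  convert h' using 3
  rw [mul_comm]
  congr 2
  push_cast
  ring

/-- The index of the first antisymmetric mode. -/
def firstIndex : TriangleIndex (-1) := ⟨(0, 1), Or.inl Nat.zero_lt_one⟩

/-- For ε = -1 the pairs increase strictly, so only (0, 1) has second entry below 2. For the other
pairs the second frequency alone carries the eigenvalue past 2π² in both uses below. -/
theorem triangleIndex_cases {i : TriangleIndex (-1)} (hi : i ∉ ({firstIndex} : Finset _)) :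
    2 ≤ i.1.2 := by
  obtain ⟨⟨m, n⟩, h⟩ := i
  have h1 : m < n := h.elim id fun h => absurd h.2 (by norm_num)
  by_contra hcon
  push Not at hcon
  simp only at hcon
  refine hi (Finset.mem_singleton.2 (Subtype.ext (Prod.ext ?_ ?_)))
  · simp only [firstIndex]
    omega
  · simp only [firstIndex]
    omega

/-- The mode (0, 1) has eigenvalue (1/4 + 1)π², integral 32/(3π²) and squared norm 1. -/
theorem hasHeatExpansion_triangleD :
    (triangleD 2).HasHeatExpansion (1024 / (9 * Real.pi ^ 4)) := by
  have hπ := Real.pi_pos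
  obtain ⟨u, V, hu, h⟩ := exists_isHeatFlow_triangle (P := triangleD 2)
    (isBounded_triangle 2) two_pos rfl (Or.inl rfl) (Or.inr rfl)
    (hasLaplacian_triangleD two_pos) {firstIndex} (2 * Real.pi ^ 2) (by
      intro i hi
      simp only [freq_sq, ← add_mul]
      refine mul_le_mul_of_nonneg_right ?_ (sq_nonneg _)
      have hm := i.1.1.cast_nonneg (α := ℝ)
      have hn : (2 : ℝ) ≤ i.1.2 := by exact_mod_cast triangleIndex_cases hi
      nlinarith)
  refine ⟨u, V, hu, fun t ht => ?_⟩
  have e1 : freq 2 1 (0 : ℕ) = Real.pi / 2 := by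
    simp only [freq]
    push_cast
    ring
  have e2 : freq 2 1 (1 : ℕ) = Real.pi := by
    simp only [freq]
    push_cast
    ring
  have hw : modeWeight (triangleD 2) (freq 2 1 (0 : ℕ)) (freq 2 1 (1 : ℕ)) (-1) =
      1024 / (9 * Real.pi ^ 4) := by
    rw [modeWeight, show (triangleD 2).carrier = triangle 2 from rfl,
      integral_mode_freq_mul_mode_freq two_pos (Or.inl rfl) (Or.inr rfl) (0, 1) (0, 1), e1, e2,
      integral_mode_triangle zero_le_two (by positivity) (by positivity) (by positivity)
      (by linarith), div_mul_cancel₀ _ (two_ne_zero' ℝ), mul_comm Real.pi 2, Real.cos_two_pi,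
      Real.cos_add_two_pi, Real.cos_sub_two_pi, Real.cos_pi,
      show Real.pi / 2 + Real.pi = 3 * Real.pi / 2 by ring,
      show Real.pi / 2 - Real.pi = -(Real.pi / 2) by ring]
    simp only [if_true, zero_ne_one, one_ne_zero, if_false]
    field_simp
    norm_num
  have h' := h t ht
  simp only [Finset.sum_singleton, firstIndex] at h'
  rw [hw, freq_sq, freq_sq] at h'
  convert h' using 3
  rw [mul_comm]
  congr 2
  push_cast
  ring

/-- The mode (0, 1) has eigenvalue (1/4 + 9/4)π²/2, integral 16/(3π²) and squared norm 1/2. -/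
theorem hasHeatExpansion_triangleNLeg_sqrt_two :
    (triangleNLeg √2).HasHeatExpansion (512 / (9 * Real.pi ^ 4)) := by
  have hπ := Real.pi_pos
  have h2 : 0 < √2 := Real.sqrt_pos.2 two_pos
  have hsq : √2 ^ 2 = 2 := Real.sq_sqrt zero_le_two
  obtain ⟨u, V, hu, h⟩ := exists_isHeatFlow_triangle (P := triangleNLeg √2)
    (isBounded_triangle √2) h2 rfl (Or.inr rfl) (Or.inr rfl)
    (hasLaplacian_triangleNLeg h2) {firstIndex} (2 * Real.pi ^ 2) (by
      intro i hi
      simp only [freq_sq, ← add_mul, hsq]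
      refine mul_le_mul_of_nonneg_right ?_ (sq_nonneg _)
      have hm := i.1.1.cast_nonneg (α := ℝ)
      have hn : (2 : ℝ) ≤ i.1.2 := by exact_mod_cast triangleIndex_cases hi
      nlinarith)
  refine ⟨u, V, hu, fun t ht => ?_⟩
  have e1 : freq √2 (1 / 2) (0 : ℕ) = Real.pi / 2 / √2 := by
    simp only [freq]
    push_cast
    ring
  have e2 : freq √2 (1 / 2) (1 : ℕ) = 3 * Real.pi / 2 / √2 := by
    simp only [freq]
    push_cast
    ring
  have hcos : Real.cos (3 * Real.pi / 2) = 0 := by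
    rw [show 3 * Real.pi / 2 = Real.pi / 2 + Real.pi by ring, Real.cos_add_pi, Real.cos_pi_div_two,
      neg_zero]
  have hw : modeWeight (triangleNLeg √2) (freq √2 (1 / 2) (0 : ℕ)) (freq √2 (1 / 2) (1 : ℕ)) (-1) =
      512 / (9 * Real.pi ^ 4) := by
    rw [modeWeight, show (triangleNLeg √2).carrier = triangle √2 from rfl,
      integral_mode_freq_mul_mode_freq h2 (Or.inr rfl) (Or.inr rfl) (0, 1) (0, 1), e1, e2,
      integral_mode_triangle h2.le (by positivity) (by positivity) (by positivity)
      (by rw [← sub_div]; exact div_ne_zero (by linarith) h2.ne'), div_mul_cancel₀ _ h2.ne',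
      div_mul_cancel₀ _ h2.ne', hcos, Real.cos_pi_div_two,
      show Real.pi / 2 + 3 * Real.pi / 2 = 2 * Real.pi by ring,
      show Real.pi / 2 - 3 * Real.pi / 2 = -Real.pi by ring, Real.cos_neg, Real.cos_two_pi,
      Real.cos_pi]
    simp only [if_true, zero_ne_one, one_ne_zero, if_false]
    field_simp
    rw [show √2 ^ 4 = (√2 ^ 2) ^ 2 by ring, hsq]
    norm_num
  have h' := h t ht
  simp only [Finset.sum_singleton, firstIndex] at h'
  rw [hw, freq_sq, freq_sq, hsq] at h'
  convert h' using 3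
  rw [mul_comm]
  congr 2
  push_cast
  ring

/-- The lowest eigenvalue, of the symmetric mode (0, 0), is already 2π², so no leading term is kept.
-/
theorem hasHeatExpansion_triangleNHyp : (triangleNHyp 1).HasHeatExpansion 0 := by
  obtain ⟨u, V, hu, h⟩ := exists_isHeatFlow_triangle (P := triangleNHyp 1)
    (isBounded_triangle 1) one_pos rfl (Or.inl rfl) (Or.inl rfl)
    (hasLaplacian_triangleNHyp one_pos) ∅ (2 * Real.pi ^ 2) (by
      intro i _
      simp only [freq_sq, ← add_mul]
      refine mul_le_mul_of_nonneg_right ?_ (sq_nonneg _)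
      have hm := i.1.1.cast_nonneg (α := ℝ)
      have hn := i.1.2.cast_nonneg (α := ℝ)
      nlinarith)
  exact ⟨u, V, hu, fun t ht => by simpa using h t ht⟩

/-- Antisymmetry excludes (0, 0), and the lowest eigenvalue is (1/4 + 9/4)π² = 5π²/2. -/
theorem hasHeatExpansion_triangleNLeg_one : (triangleNLeg 1).HasHeatExpansion 0 := by
  obtain ⟨u, V, hu, h⟩ := exists_isHeatFlow_triangle (P := triangleNLeg 1)
    (isBounded_triangle 1) one_pos rfl (Or.inr rfl) (Or.inr rfl)
    (hasLaplacian_triangleNLeg one_pos) ∅ (2 * Real.pi ^ 2) (by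
      intro i _
      simp only [freq_sq, ← add_mul]
      refine mul_le_mul_of_nonneg_right ?_ (sq_nonneg _)
      have hm := i.1.1.cast_nonneg (α := ℝ)
      have h1 : 1 ≤ i.1.2 := by
        rcases i.2 with h | h
        · omega
        · exact absurd h.2 (by norm_num)
      have hn : (1 : ℝ) ≤ i.1.2 := by exact_mod_cast h1
      nlinarith)
  exact ⟨u, V, hu, fun t ht => by simpa using h t ht⟩

end MixedDomain

/-! ### Assembling the bands and comparing leading terms -/

namespace Band

open MixedDomain

theorem wellPosed_and_isBigO {M : Band} (hM : ∀ i, Bornology.IsBounded (M i).carrier)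
    {C : Fin 3 → ℝ} (h : ∀ i, (M i).HasHeatExpansion (C i)) :
    M.WellPosed ∧
    (fun t : ℝ => M.heatContent t - (∑ i, C i) * Real.exp (-(5 * Real.pi ^ 2 * t / 4)))
      =O[atTop] fun t : ℝ => Real.exp (-(2 * Real.pi ^ 2 * t)) := by
  choose u V hu hV using h
  have hex : ∃ u, M.IsHeatFlow u := ⟨u, hu⟩
  have huniq : ∀ u v, M.IsHeatFlow u → M.IsHeatFlow v → ∀ i, ∀ t : ℝ, 0 ≤ t → u i t = v i t :=
    fun u v hu hv i t ht => (hu i).eq_of_nonneg (hM i) (hv i) ht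
  refine ⟨⟨hex, huniq⟩, IsBigO.of_bound (∑ i, V i) ?_⟩
  filter_upwards [eventually_gt_atTop 0] with t ht
  -- `heatContent` integrates an arbitrarily chosen flow; uniqueness identifies it with the one
  -- constructed from modes.
  have hq : M.heatContent t = ∑ i, ∫ p, u i t p ∂(M i).measure := by
    rw [heatContent, dif_pos hex]
    refine Finset.sum_congr rfl fun i _ => ?_
    rw [huniq _ _ hex.choose_spec hu i t ht.le]
  rw [hq, Finset.sum_mul, ← Finset.sum_sub_distrib, Real.norm_eq_abs, Real.norm_eq_abs,
    Real.abs_exp, Finset.sum_mul]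
  exact (Finset.abs_sum_le_sum_abs _ _).trans (Finset.sum_le_sum fun i _ => hV i t ht)

/-- Bands whose heat contents have different leading terms are not isoheat. -/
theorem not_isoheat_of_isBigO {M N : Band} {a b : ℝ} (hab : a ≠ b)
    (hM : (fun t : ℝ => M.heatContent t - a * Real.exp (-(5 * Real.pi ^ 2 * t / 4)))
      =O[atTop] fun t : ℝ => Real.exp (-(2 * Real.pi ^ 2 * t)))
    (hN : (fun t : ℝ => N.heatContent t - b * Real.exp (-(5 * Real.pi ^ 2 * t / 4)))
      =O[atTop] fun t : ℝ => Real.exp (-(2 * Real.pi ^ 2 * t))) : ¬ Isoheat M N := by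
  intro h
  have hd := hN.sub hM
  have h1 : (fun t : ℝ => (a - b) * Real.exp (-(5 * Real.pi ^ 2 * t / 4)))
      =O[atTop] fun t : ℝ => Real.exp (-(2 * Real.pi ^ 2 * t)) := by
    refine hd.congr' ?_ EventuallyEq.rfl
    filter_upwards [eventually_gt_atTop 0] with t ht
    rw [h t ht]
    ring
  -- Multiplying by exp(5π²t/4) turns the bound into a - b = O(exp(-3π²t/4)), which forces a = b.
  have h2 := h1.mul (isBigO_refl (fun t : ℝ => Real.exp (5 * Real.pi ^ 2 * t / 4)) atTop)
  have hlim : Tendsto (fun t : ℝ => Real.exp (-(2 * Real.pi ^ 2 * t)) *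
      Real.exp (5 * Real.pi ^ 2 * t / 4)) atTop (𝓝 0) := by
    have e : ∀ t : ℝ, Real.exp (-(2 * Real.pi ^ 2 * t)) * Real.exp (5 * Real.pi ^ 2 * t / 4) =
        Real.exp (-(3 * Real.pi ^ 2 / 4 * t)) := fun t => by
      rw [← Real.exp_add]
      ring_nf
    simp only [e]
    refine Real.tendsto_exp_neg_atTop_nhds_zero.comp (tendsto_id.const_mul_atTop ?_)
    have := Real.pi_pos
    positivity
  have h3 := h2.trans_tendsto hlim
  have h4 : Tendsto (fun _ : ℝ => a - b) atTop (𝓝 0) := by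
    refine h3.congr fun t => ?_
    rw [mul_assoc, ← Real.exp_add]
    simp
  exact hab (sub_eq_zero.1 (tendsto_nhds_unique tendsto_const_nhds h4))

end Band

theorem corollary3 :
    bandA.WellPosed ∧ bandB.WellPosed ∧
    ¬ Band.Isoheat bandA bandB ∧
    ((fun t : ℝ => bandA.heatContent t
        - 1600 / (9 * Real.pi ^ 4) * Real.exp (-(5 * Real.pi ^ 2 * t / 4)))
      =O[atTop] fun t : ℝ => Real.exp (-(2 * Real.pi ^ 2 * t))) ∧
    ((fun t : ℝ => bandB.heatContent t
        - 1664 / (9 * Real.pi ^ 4) * Real.exp (-(5 * Real.pi ^ 2 * t / 4)))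
      =O[atTop] fun t : ℝ => Real.exp (-(2 * Real.pi ^ 2 * t))) := by
  have hπ := Real.pi_pos
  obtain ⟨hA, hA'⟩ := Band.wellPosed_and_isBigO (M := bandA)
    (C := ![64 / Real.pi ^ 4, 1024 / (9 * Real.pi ^ 4), 0])
    (Fin.forall_fin_succ.2 ⟨MixedDomain.isBounded_rectangle 1 1, Fin.forall_fin_two.2
      ⟨MixedDomain.isBounded_triangle 2, MixedDomain.isBounded_triangle 1⟩⟩)
    (Fin.forall_fin_succ.2 ⟨MixedDomain.hasHeatExpansion_rectangleN, Fin.forall_fin_two.2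
      ⟨MixedDomain.hasHeatExpansion_triangleD, MixedDomain.hasHeatExpansion_triangleNHyp⟩⟩)
  obtain ⟨hB, hB'⟩ := Band.wellPosed_and_isBigO (M := bandB)
    (C := ![512 / (9 * Real.pi ^ 4), 128 / Real.pi ^ 4, 0])
    (Fin.forall_fin_succ.2 ⟨MixedDomain.isBounded_triangle √2, Fin.forall_fin_two.2
      ⟨MixedDomain.isBounded_rectangle 2 1, MixedDomain.isBounded_triangle 1⟩⟩)
    (Fin.forall_fin_succ.2 ⟨MixedDomain.hasHeatExpansion_triangleNLeg_sqrt_two, Fin.forall_fin_two.2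
      ⟨MixedDomain.hasHeatExpansion_rectangleD, MixedDomain.hasHeatExpansion_triangleNLeg_one⟩⟩)
  -- In units of 1/(9π⁴) the totals are 576 + 1024 = 1600 for A and 512 + 1152 = 1664 for B.
  have sA : ∑ i, ![64 / Real.pi ^ 4, 1024 / (9 * Real.pi ^ 4), 0] i = 1600 / (9 * Real.pi ^ 4) := by
    simp [Fin.sum_univ_succ]
    field_simp
    norm_num
  have sB : ∑ i, ![512 / (9 * Real.pi ^ 4), 128 / Real.pi ^ 4, 0] i = 1664 / (9 * Real.pi ^ 4) := by
    simp [Fin.sum_univ_succ]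
    field_simp
    norm_num
  rw [sA] at hA'
  rw [sB] at hB'
  refine ⟨hA, hB, Band.not_isoheat_of_isBigO ?_ hA' hB', hA', hB'⟩
  rw [Ne, div_left_inj' (by positivity)]
  norm_num
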